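/- Let $k$ be a field of characteristic $0$ and let $P=k((x_1))((x_2))((\partial_1^{-1}))((\partial_2^{-1}))$ be the ring of formal pseudo-differential operators in two variables, with multiplication given by the Leibniz rule. Write $L=L_++L_-$, where $L_+$ contains the nonnegative and $L_-$ the negative powers of $\partial_2$. Let $\mathrm{res}(L)$ be the coefficient of $L$ at $x_1^{-1}x_2^{-1}\partial_1^{-1}\partial_2^{-1}$, and for $L=(L_1,L_2)$, $M=(M_1,M_2)\in P^2$ put $\langle L,M\rangle=\mathrm{res}(L_1M_1)+\mathrm{res}(L_2M_2)$. Let $P'=\{L\in P^2:[L_1,L_2]=0\}$; a vector $X\in P^2$ is tangent to $P'$ at $L\in P'$ if $[L_1+\epsilon X_1,L_2+\epsilon X_2]=0$ modulo $\epsilon^2$. Let $\mathcal F(P^2)$ be the space of functions $F:P^2\to k$ that are polynomials of bounded degree in any (possibly infinite) number of coefficients of $L_1,L_2$, with only finitely many nonzero terms at each point. The gradient $\nabla_F(L)\in P^2$ is determined by $\langle M,\nabla_F(L)\rangle=\frac{d}{d\epsilon}F(L+\epsilon M)|_{\epsilon=0}$ for all $M\in P^2$, and $$\{F,G\}_R(L)=\langle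 L,[\nabla_F(L),\nabla_G(L)]_R\rangle,\qquad [X,Y]_R=[X_+,Y_+]-[X_-,Y_-]\ \text{(componentwise)}.$$ For $m\ge 1$ put $$H_m(L)=\frac1m\sum_{a+b=m,\ a,b\ge 0}\binom ma\,\mathrm{res}(L_1^aL_2^b).$$ Then every $F\in\mathcal F(P^2)$ has exactly one gradient at every point, $H_m\in\mathcal F(P^2)$ for all $m\geq 1$, and the Hamiltonian systems $$\frac{\partial F}{\partial t_m}=\{F,H_m\}_R,\quad F\in\mathcal F(P^2),$$ have the following properties. (i) $P'$ is invariant, and on $P'$ the system has the form $$\frac{\partial L_i}{\partial t_m}=\big[\big((L_1+L_2)^{m-1}\big)_+,L_i\big],\qquad i=1,2.$$ That is: at each $L\in P'$ the vector $X=\big([((L_1+L_2)^{m-1})_+,L_i]\big)_{i=1,2}$ is the only $X\in P^2$ such that, for all $F\in\mathcal F(P^2)$, the derivative of $F$ at $L$ in the direction $X$ is $\{F,H_m\}_R(L)$, and it is tangent to $P'$. Moreover let $T$ be any set of positive integers and let $L(t)$ be a pair of formal power series in the times $t_m$, $m\in T$, with coefficients in $P$. If $L(t)$ satisfies the Hamiltonian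 systems for all $m\in T$ and $L(0)\in P'$, then $[L_1(t),L_2(t)]=0$; and if $[L_1(t),L_2(t)]=0$, then for each $m\in T$ the series $L(t)$ satisfies the Hamiltonian system for $m$ if and only if it satisfies the displayed equations for $m$. (ii) The $H_m$ are integrals of motion on $P'$: for every formal solution $L(t)$, as in (i), of the Hamiltonian systems for $m\in T$ with $L(0)\in P'$, and for every $m'\ge 1$, all the derivatives $\partial H_{m'}(L(t))/\partial t_m$, $m\in T$, vanish. Moreover $\{H_m,H_{m'}\}_R=0$ on $P'$ for all $m,m'\ge 1$. -/

import Mathlib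

namespace PDO

/-- A derivation of an associative, not necessarily commutative, ring. -/
structure RingDeriv (A : Type*) [Ring A] extends A →+ A where
  leibniz' : ∀ a b : A, toFun (a * b) = toFun a * b + a * toFun b

namespace RingDeriv

instance {A : Type*} [Ring A] : FunLike (RingDeriv A) A A where
  coe d := d.toFun
  coe_injective d e h := by
    cases d; cases e
    congr
    exact DFunLike.coe_injective h

instance {A : Type*} [Ring A] : AddMonoidHomClass (RingDeriv A) A A where
  map_add d := d.map_add'
  map_zero d := d.map_zero'

theorem leibniz {A : Type*} [Ring A] (d : RingDeriv A) (a b : A) :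
    d (a * b) = d a * b + a * d b := d.leibniz' a b

theorem map_one' {A : Type*} [Ring A] (d : RingDeriv A) : d 1 = 0 := by
  have h := d.leibniz 1 1
  simpa using h

theorem iter_zero {A : Type*} [Ring A] (d : RingDeriv A) (n : ℕ) : d^[n] 0 = 0 := by
  induction n with
  | zero => rfl
  | succ n ih => rw [Function.iterate_succ_apply', ih, map_zero]

theorem iter_add {A : Type*} [Ring A] (d : RingDeriv A) (n : ℕ) (a b : A) :
    d^[n] (a + b) = d^[n] a + d^[n] b := by
  induction n with
  | zero => rfl
  | succ n ih => simp only [Function.iterate_succ_apply', ih, map_add]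

theorem iter_zsmul {A : Type*} [Ring A] (d : RingDeriv A) (n : ℕ) (z : ℤ) (a : A) :
    d^[n] (z • a) = z • d^[n] a := by
  induction n with
  | zero => rfl
  | succ n ih => simp only [Function.iterate_succ_apply', ih, map_zsmul]

theorem iter_one {A : Type*} [Ring A] (d : RingDeriv A) {n : ℕ} (hn : n ≠ 0) : d^[n] 1 = 0 := by
  obtain ⟨m, rfl⟩ := Nat.exists_eq_succ_of_ne_zero hn
  rw [Function.iterate_succ_apply, map_one', iter_zero]

theorem iter_mul {A : Type*} [Ring A] (d : RingDeriv A) (n : ℕ) (a b : A) :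
    d^[n] (a * b) =
      ∑ ij ∈ Finset.HasAntidiagonal.antidiagonal n, n.choose ij.1 • (d^[ij.1] a * d^[ij.2] b) := by
  induction n with
  | zero => simp
  | succ n ih =>
    rw [Finset.sum_antidiagonal_choose_succ_nsmul (fun i j => d^[i] a * d^[j] b) n]
    simp only [Function.iterate_succ_apply', ih, map_sum, map_nsmul, leibniz, smul_add,
      Finset.sum_add_distrib]
    rw [add_comm]
    congr 1
    refine Finset.sum_congr rfl fun ⟨i, j⟩ hij => ?_
    rw [n.choose_symm_of_eq_add (Finset.HasAntidiagonal.mem_antidiagonal.1 hij).symm]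

theorem iter_sum {A ι : Type*} [Ring A] (d : RingDeriv A) (n : ℕ) (s : Finset ι) (f : ι → A) :
    d^[n] (∑ i ∈ s, f i) = ∑ i ∈ s, d^[n] (f i) := by
  classical
  induction s using Finset.induction_on with
  | empty => simp
  | insert i s hi ih => rw [Finset.sum_insert hi, Finset.sum_insert hi, iter_add, ih]

theorem iter_comm {A : Type*} [Ring A] (d e : RingDeriv A) (h : ∀ a, d (e a) = e (d a)) (n : ℕ)
    (a : A) : e (d^[n] a) = d^[n] (e a) := by
  induction n with
  | zero => rfl
  | succ n ih => rw [Function.iterate_succ_apply', Function.iterate_succ_apply', ← h, ih]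

end RingDeriv

/-- The ring `A((∂⁻¹))` of formal pseudo-differential operators `∑ aₙ ∂ⁿ` (coefficients on the
left, only finitely many positive powers of `∂`) over a ring `A` with a derivation `d`. -/
structure PseudoDiff (A : Type*) [Ring A] (d : RingDeriv A) where
  /-- The coefficient at `∂ⁿ`. -/
  coeff : ℤ → A
  bdd : ∃ N : ℤ, ∀ n, N < n → coeff n = 0

namespace PseudoDiff

variable {A : Type*} [Ring A] {d : RingDeriv A}

@[ext] theorem ext {f g : PseudoDiff A d} (h : ∀ n, f.coeff n = g.coeff n) : f = g := by
  cases f; cases g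
  congr
  exact funext h

theorem coeff_injective : Function.Injective (coeff : PseudoDiff A d → ℤ → A) :=
  fun _ _ h => ext fun n => congrFun h n

instance : Zero (PseudoDiff A d) := ⟨⟨0, 0, fun _ _ => rfl⟩⟩

instance : Add (PseudoDiff A d) := ⟨fun f g => ⟨f.coeff + g.coeff, by
  obtain ⟨a, ha⟩ := f.bdd
  obtain ⟨b, hb⟩ := g.bdd
  refine ⟨max a b, fun n hn => ?_⟩
  rw [Pi.add_apply, ha n (lt_of_le_of_lt (le_max_left a b) hn),
    hb n (lt_of_le_of_lt (le_max_right a b) hn), add_zero]⟩⟩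

instance : Neg (PseudoDiff A d) := ⟨fun f => ⟨-f.coeff, by
  obtain ⟨a, ha⟩ := f.bdd
  exact ⟨a, fun n hn => by rw [Pi.neg_apply, ha n hn, neg_zero]⟩⟩⟩

instance : Sub (PseudoDiff A d) := ⟨fun f g => ⟨f.coeff - g.coeff, by
  obtain ⟨a, ha⟩ := f.bdd
  obtain ⟨b, hb⟩ := g.bdd
  refine ⟨max a b, fun n hn => ?_⟩
  rw [Pi.sub_apply, ha n (lt_of_le_of_lt (le_max_left a b) hn),
    hb n (lt_of_le_of_lt (le_max_right a b) hn), sub_zero]⟩⟩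

instance {k : Type*} [SMulZeroClass k A] : SMul k (PseudoDiff A d) := ⟨fun c f => ⟨c • f.coeff, by
  obtain ⟨a, ha⟩ := f.bdd
  exact ⟨a, fun n hn => by rw [Pi.smul_apply, ha n hn, smul_zero]⟩⟩⟩

@[simp] theorem coeff_zero (n : ℤ) : (0 : PseudoDiff A d).coeff n = 0 := rfl

@[simp] theorem coeff_add (f g : PseudoDiff A d) (n : ℤ) :
    (f + g).coeff n = f.coeff n + g.coeff n := rfl

@[simp] theorem coeff_neg (f : PseudoDiff A d) (n : ℤ) : (-f).coeff n = -f.coeff n := rfl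

@[simp] theorem coeff_sub (f g : PseudoDiff A d) (n : ℤ) :
    (f - g).coeff n = f.coeff n - g.coeff n := rfl

@[simp] theorem coeff_smul {k : Type*} [SMulZeroClass k A] (c : k) (f : PseudoDiff A d) (n : ℤ) :
    (c • f).coeff n = c • f.coeff n := rfl

instance : AddCommGroup (PseudoDiff A d) :=
  coeff_injective.addCommGroup coeff rfl (fun _ _ => rfl) (fun _ => rfl) (fun _ _ => rfl)
    (fun _ _ => rfl) (fun _ _ => rfl)

instance {k : Type*} [Semiring k] [Module k A] : Module k (PseudoDiff A d) :=
  coeff_injective.module k ⟨⟨coeff, rfl⟩, fun _ _ => rfl⟩ (fun _ _ => rfl)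

/-- The coefficient at `∂ⁿ` of the product of the monomials `x ∂ⁱ` and `y ∂ʲ`, which is
`binom(i, r) x dʳ(y)` with `r = i + j - n` if `r ≥ 0`, and zero otherwise. -/
def mulTerm (d : RingDeriv A) (n i j : ℤ) (x y : A) : A :=
  if n ≤ i + j then Ring.choose i (i + j - n).toNat • (x * d^[(i + j - n).toNat] y) else 0

theorem mulTerm_of_lt {n i j : ℤ} (h : i + j < n) (x y : A) : mulTerm d n i j x y = 0 :=
  if_neg (not_le.2 h)

theorem mulTerm_zero_left (n i j : ℤ) (y : A) : mulTerm d n i j 0 y = 0 := by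
  simp [mulTerm]

theorem mulTerm_zero_right (n i j : ℤ) (x : A) : mulTerm d n i j x 0 = 0 := by
  simp [mulTerm]

theorem mulTerm_add_left (n i j : ℤ) (x x' y : A) :
    mulTerm d n i j (x + x') y = mulTerm d n i j x y + mulTerm d n i j x' y := by
  unfold mulTerm
  split_ifs
  · rw [add_mul, smul_add]
  · rw [add_zero]

theorem mulTerm_add_right (n i j : ℤ) (x y y' : A) :
    mulTerm d n i j x (y + y') = mulTerm d n i j x y + mulTerm d n i j x y' := by
  unfold mulTerm
  split_ifs
  · rw [RingDeriv.iter_add, mul_add, smul_add]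
  · rw [add_zero]

theorem mulTerm_sum_left {ι : Type*} (s : Finset ι) (n i j : ℤ) (x : ι → A) (y : A) :
    mulTerm d n i j (∑ a ∈ s, x a) y = ∑ a ∈ s, mulTerm d n i j (x a) y := by
  unfold mulTerm
  split_ifs
  · rw [Finset.sum_mul, Finset.smul_sum]
  · rw [Finset.sum_const_zero]

theorem mulTerm_sum_right {ι : Type*} (s : Finset ι) (n i j : ℤ) (x : A) (y : ι → A) :
    mulTerm d n i j x (∑ a ∈ s, y a) = ∑ a ∈ s, mulTerm d n i j x (y a) := by
  unfold mulTerm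
  split_ifs
  · rw [RingDeriv.iter_sum, Finset.mul_sum, Finset.smul_sum]
  · rw [Finset.sum_const_zero]

/-- Multiplication of pseudo-differential operators by the Leibniz rule
`(∑ aᵢ ∂ⁱ) (∑ bⱼ ∂ʲ) = ∑ binom(i, r) aᵢ dʳ(bⱼ) ∂ⁱ⁺ʲ⁻ʳ`. -/
noncomputable instance : Mul (PseudoDiff A d) := ⟨fun f g =>
  ⟨fun n => ∑ᶠ p : ℤ × ℤ, mulTerm d n p.1 p.2 (f.coeff p.1) (g.coeff p.2), by
    obtain ⟨a, ha⟩ := f.bdd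
    obtain ⟨b, hb⟩ := g.bdd
    refine ⟨a + b, fun n hn => finsum_eq_zero_of_forall_eq_zero fun p => ?_⟩
    by_cases h1 : a < p.1
    · rw [ha _ h1, mulTerm_zero_left]
    by_cases h2 : b < p.2
    · rw [hb _ h2, mulTerm_zero_right]
    exact mulTerm_of_lt (by omega) _ _⟩⟩

theorem coeff_mul (f g : PseudoDiff A d) (n : ℤ) : (f * g).coeff n =
    ∑ᶠ p : ℤ × ℤ, mulTerm d n p.1 p.2 (f.coeff p.1) (g.coeff p.2) := rfl

theorem coeff_mul_eq_sum {f g : PseudoDiff A d} {a b n : ℤ} (ha : ∀ i, a < i → f.coeff i = 0)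
    (hb : ∀ j, b < j → g.coeff j = 0) {M : ℤ} (h1 : a ≤ M) (h2 : b ≤ M) (h3 : -M ≤ n - b)
    (h4 : -M ≤ n - a) :
    (f * g).coeff n = ∑ i ∈ Finset.Icc (-M) M, ∑ j ∈ Finset.Icc (-M) M,
      mulTerm d n i j (f.coeff i) (g.coeff j) := by
  rw [coeff_mul, ← Finset.sum_product', finsum_eq_sum_of_support_subset]
  rintro ⟨i, j⟩ hp
  rw [Function.mem_support] at hp
  have hi : i ≤ a := by
    by_contra h
    exact hp (by rw [ha i (not_le.1 h), mulTerm_zero_left])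
  have hj : j ≤ b := by
    by_contra h
    exact hp (by rw [hb j (not_le.1 h), mulTerm_zero_right])
  have hn : n ≤ i + j := by
    by_contra h
    exact hp (mulTerm_of_lt (not_le.1 h) _ _)
  simp only [Finset.coe_product, Finset.coe_Icc, Set.mem_prod, Set.mem_Icc]
  omega

theorem coeff_mul_of_lt {f g : PseudoDiff A d} {a b n : ℤ} (ha : ∀ i, a < i → f.coeff i = 0)
    (hb : ∀ j, b < j → g.coeff j = 0) (hn : a + b < n) : (f * g).coeff n = 0 := by
  rw [coeff_mul]
  refine finsum_eq_zero_of_forall_eq_zero fun p => ?_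
  by_cases h1 : a < p.1
  · rw [ha _ h1, mulTerm_zero_left]
  by_cases h2 : b < p.2
  · rw [hb _ h2, mulTerm_zero_right]
  exact mulTerm_of_lt (by omega) _ _

theorem bdd₂ (f g : PseudoDiff A d) : ∃ a : ℤ, (∀ i, a < i → f.coeff i = 0) ∧
    ∀ i, a < i → g.coeff i = 0 := by
  obtain ⟨a, ha⟩ := f.bdd
  obtain ⟨b, hb⟩ := g.bdd
  exact ⟨max a b, fun i hi => ha i (by omega), fun i hi => hb i (by omega)⟩

/-- The sum over the middle exponent in a triple product, bracketed to the left. -/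
theorem sum_left (x y z : A) (i j l n M : ℤ) (N : ℕ) (hN : i + j + l - n = N)
    (h1 : -M ≤ n - l) (h2 : i + j ≤ M) :
    ∑ p ∈ Finset.Icc (-M) M, mulTerm d n p l (mulTerm d p i j x y) z =
      ∑ kr ∈ Finset.HasAntidiagonal.antidiagonal N,
        (Ring.choose i kr.1 * Ring.choose (i + j - kr.1) kr.2) •
          (x * d^[kr.1] y * d^[kr.2] z) := by
  symm
  refine Finset.sum_of_injOn (fun kr : ℕ × ℕ => i + j - kr.1) ?_ ?_ ?_ ?_
  · rintro ⟨k, r⟩ hk ⟨k', r'⟩ hk' h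
    simp only [Finset.mem_coe,
      Finset.HasAntidiagonal.mem_antidiagonal] at hk hk'
    simp only at h
    ext <;> simp <;> omega
  · rintro ⟨k, r⟩ hk
    simp only [Finset.mem_coe, Finset.HasAntidiagonal.mem_antidiagonal] at hk
    simp only [Finset.coe_Icc, Set.mem_Icc]
    omega
  · intro p hp hp'
    by_cases hij : i + j < p
    · rw [mulTerm_of_lt hij, mulTerm_zero_left]
    by_cases hpl : p + l < n
    · rw [mulTerm_of_lt hpl]
    refine absurd ⟨((i + j - p).toNat, (p + l - n).toNat), ?_, ?_⟩ hp'
    · simp only [Finset.mem_coe, Finset.HasAntidiagonal.mem_antidiagonal]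
      omega
    · dsimp only
      omega
  · rintro ⟨k, r⟩ hk
    simp only [Finset.HasAntidiagonal.mem_antidiagonal] at hk
    have e1 : (i + j - (i + j - (k : ℤ))).toNat = k := by omega
    have e2 : (i + j - (k : ℤ) + l - n).toNat = r := by omega
    simp only [mulTerm]
    rw [if_pos (by omega), if_pos (by omega), e1, e2, smul_mul_assoc, smul_smul, mul_comm]

/-- The sum over the middle exponent in a triple product, bracketed to the right. -/
theorem sum_right (x y z : A) (i j l n M : ℤ) (N : ℕ) (hN : i + j + l - n = N)
    (h1 : -M ≤ n - i) (h2 : j + l ≤ M) :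
    ∑ q ∈ Finset.Icc (-M) M, mulTerm d n i q x (mulTerm d q j l y z) =
      ∑ ts ∈ Finset.HasAntidiagonal.antidiagonal N,
        (Ring.choose i ts.1 * Ring.choose j ts.2) •
          (x * d^[ts.1] (y * d^[ts.2] z)) := by
  symm
  refine Finset.sum_of_injOn (fun ts : ℕ × ℕ => j + l - ts.2) ?_ ?_ ?_ ?_
  · rintro ⟨k, r⟩ hk ⟨k', r'⟩ hk' h
    simp only [Finset.mem_coe,
      Finset.HasAntidiagonal.mem_antidiagonal] at hk hk'
    simp only at h
    ext <;> simp <;> omega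
  · rintro ⟨k, r⟩ hk
    simp only [Finset.mem_coe, Finset.HasAntidiagonal.mem_antidiagonal] at hk
    simp only [Finset.coe_Icc, Set.mem_Icc]
    omega
  · intro q hq hq'
    by_cases hjl : j + l < q
    · rw [mulTerm_of_lt hjl, mulTerm_zero_right]
    by_cases hiq : i + q < n
    · rw [mulTerm_of_lt hiq]
    refine absurd ⟨((i + q - n).toNat, (j + l - q).toNat), ?_, ?_⟩ hq'
    · simp only [Finset.mem_coe, Finset.HasAntidiagonal.mem_antidiagonal]
      omega
    · dsimp only
      omega
  · rintro ⟨t, s⟩ hk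
    simp only [Finset.HasAntidiagonal.mem_antidiagonal] at hk
    have e1 : (j + l - (j + l - (s : ℤ))).toNat = s := by omega
    have e2 : (i + (j + l - (s : ℤ)) - n).toNat = t := by omega
    simp only [mulTerm]
    rw [if_pos (by omega), if_pos (by omega), e1, e2, RingDeriv.iter_zsmul, mul_smul_comm,
      smul_smul]

theorem sum_triple (x y z : A) (i j : ℤ) (N : ℕ) :
    ∑ kr ∈ Finset.HasAntidiagonal.antidiagonal N, (Ring.choose i kr.1 * Ring.choose (i + j - kr.1) kr.2) •
          (x * d^[kr.1] y * d^[kr.2] z) =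
      ∑ ts ∈ Finset.HasAntidiagonal.antidiagonal N, (Ring.choose i ts.1 * Ring.choose j ts.2) •
          (x * d^[ts.1] (y * d^[ts.2] z)) := by
  have hL : ∀ kr ∈ Finset.HasAntidiagonal.antidiagonal N,
      (Ring.choose i kr.1 * Ring.choose (i + j - kr.1) kr.2) • (x * d^[kr.1] y * d^[kr.2] z) =
      ∑ vs ∈ Finset.HasAntidiagonal.antidiagonal kr.2, (Ring.choose i kr.1 * (Ring.choose (i - kr.1) vs.1 *
        Ring.choose j vs.2)) • (x * (d^[kr.1] y * d^[kr.2] z)) := by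
    rintro ⟨k, r⟩ -
    have := Ring.add_choose_eq (r := i - (k : ℤ)) (s := j) r (Commute.all _ _)
    simp only
    rw [show i + j - (k : ℤ) = i - k + j by ring, this, Finset.mul_sum, Finset.sum_smul, mul_assoc]
  have hR : ∀ ts ∈ Finset.HasAntidiagonal.antidiagonal N,
      (Ring.choose i ts.1 * Ring.choose j ts.2) • (x * d^[ts.1] (y * d^[ts.2] z)) =
      ∑ uv ∈ Finset.HasAntidiagonal.antidiagonal ts.1, (Ring.choose i uv.1 * (Ring.choose (i - uv.1) uv.2 *
        Ring.choose j ts.2)) • (x * (d^[uv.1] y * d^[uv.2 + ts.2] z)) := by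
    rintro ⟨t, s⟩ -
    simp only
    rw [RingDeriv.iter_mul, Finset.mul_sum, Finset.smul_sum]
    refine Finset.sum_congr rfl ?_
    rintro ⟨u, v⟩ huv
    rw [Finset.HasAntidiagonal.mem_antidiagonal] at huv
    simp only at huv ⊢
    have hc := Ring.choose_smul_choose i (n := t) (k := u) (by omega)
    rw [show t - u = v by omega, nsmul_eq_mul] at hc
    rw [mul_smul_comm, ← Function.iterate_add_apply, ← natCast_zsmul, smul_smul]
    congr 1
    linear_combination Ring.choose j s * hc
  rw [Finset.sum_congr rfl hL, Finset.sum_congr rfl hR, Finset.sum_sigma', Finset.sum_sigma']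
  refine Finset.sum_nbij' (fun w => ⟨(w.1.1 + w.2.1, w.2.2), (w.1.1, w.2.1)⟩)
    (fun w => ⟨(w.2.1, w.2.2 + w.1.2), (w.2.2, w.1.2)⟩) ?_ ?_ ?_ ?_ ?_
  · rintro ⟨⟨a, b⟩, ⟨c, e⟩⟩ h
    simp only [Finset.mem_sigma, Finset.HasAntidiagonal.mem_antidiagonal] at h ⊢
    exact ⟨by omega, trivial⟩
  · rintro ⟨⟨a, b⟩, ⟨c, e⟩⟩ h
    simp only [Finset.mem_sigma, Finset.HasAntidiagonal.mem_antidiagonal] at h ⊢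
    exact ⟨by omega, trivial⟩
  · rintro ⟨⟨a, b⟩, ⟨c, e⟩⟩ h
    simp only [Finset.mem_sigma, Finset.HasAntidiagonal.mem_antidiagonal] at h ⊢
    obtain ⟨h1, rfl⟩ := h
    rfl
  · rintro ⟨⟨a, b⟩, ⟨c, e⟩⟩ h
    simp only [Finset.mem_sigma, Finset.HasAntidiagonal.mem_antidiagonal] at h ⊢
    obtain ⟨h1, rfl⟩ := h
    rfl
  · rintro ⟨⟨a, b⟩, ⟨c, e⟩⟩ h
    simp only [Finset.mem_sigma, Finset.HasAntidiagonal.mem_antidiagonal] at h ⊢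
    obtain ⟨h1, rfl⟩ := h
    rfl

theorem mulTerm_assoc (x y z : A) (i j l n M : ℤ) (h1 : -M ≤ n - l) (h2 : i + j ≤ M)
    (h3 : -M ≤ n - i) (h4 : j + l ≤ M) :
    ∑ p ∈ Finset.Icc (-M) M, mulTerm d n p l (mulTerm d p i j x y) z =
      ∑ q ∈ Finset.Icc (-M) M, mulTerm d n i q x (mulTerm d q j l y z) := by
  by_cases h : i + j + l < n
  · rw [Finset.sum_eq_zero, Finset.sum_eq_zero]
    · intro q _
      by_cases hq : i + q < n
      · exact mulTerm_of_lt hq _ _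
      · rw [mulTerm_of_lt (by omega : j + l < q), mulTerm_zero_right]
    · intro p _
      by_cases hp : p + l < n
      · exact mulTerm_of_lt hp _ _
      · rw [mulTerm_of_lt (by omega : i + j < p), mulTerm_zero_left]
  · obtain ⟨N, hN⟩ := Int.eq_ofNat_of_zero_le (show 0 ≤ i + j + l - n by omega)
    rw [sum_left x y z i j l n M N hN h1 h2, sum_right x y z i j l n M N hN h3 h4, sum_triple]

protected theorem mul_assoc (f g h : PseudoDiff A d) : f * g * h = f * (g * h) := by
  ext n
  obtain ⟨a, ha⟩ := f.bdd
  obtain ⟨b, hb⟩ := g.bdd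
  obtain ⟨c, hc⟩ := h.bdd
  obtain ⟨M, hM⟩ : ∃ M : ℤ, M = |a| + |b| + |c| + |n| := ⟨_, rfl⟩
  have a1 := le_abs_self a
  have a2 := abs_nonneg a
  have b1 := le_abs_self b
  have b2 := abs_nonneg b
  have c1 := le_abs_self c
  have c2 := abs_nonneg c
  have n1 := neg_abs_le n
  have n2 := abs_nonneg n
  rw [coeff_mul_eq_sum (a := a + b) (b := c) (M := M)
      (fun p hp => coeff_mul_of_lt ha hb hp) hc (by omega) (by omega) (by omega) (by omega),
    coeff_mul_eq_sum (a := a) (b := b + c) (M := M) ha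
      (fun p hp => coeff_mul_of_lt hb hc hp) (by omega) (by omega) (by omega) (by omega)]
  have hL : ∀ p ∈ Finset.Icc (-M) M, ∀ l ∈ Finset.Icc (-M) M,
      mulTerm d n p l ((f * g).coeff p) (h.coeff l) =
      ∑ i ∈ Finset.Icc (-M) M, ∑ j ∈ Finset.Icc (-M) M,
        mulTerm d n p l (mulTerm d p i j (f.coeff i) (g.coeff j)) (h.coeff l) := by
    intro p _ l _
    by_cases hpl : p + l < n
    · simp only [mulTerm_of_lt hpl, Finset.sum_const_zero]
    by_cases hl : c < l
    · simp only [hc l hl, mulTerm_zero_right, Finset.sum_const_zero]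
    rw [coeff_mul_eq_sum (M := M) ha hb (by omega) (by omega) (by omega) (by omega),
      mulTerm_sum_left]
    simp only [mulTerm_sum_left]
  have hR : ∀ i ∈ Finset.Icc (-M) M, ∀ q ∈ Finset.Icc (-M) M,
      mulTerm d n i q (f.coeff i) ((g * h).coeff q) =
      ∑ j ∈ Finset.Icc (-M) M, ∑ l ∈ Finset.Icc (-M) M,
        mulTerm d n i q (f.coeff i) (mulTerm d q j l (g.coeff j) (h.coeff l)) := by
    intro i _ q _
    by_cases hiq : i + q < n
    · simp only [mulTerm_of_lt hiq, Finset.sum_const_zero]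
    by_cases hi : a < i
    · simp only [ha i hi, mulTerm_zero_left, Finset.sum_const_zero]
    rw [coeff_mul_eq_sum (M := M) hb hc (by omega) (by omega) (by omega) (by omega),
      mulTerm_sum_right]
    simp only [mulTerm_sum_right]
  rw [Finset.sum_congr rfl fun p hp => Finset.sum_congr rfl (hL p hp),
    Finset.sum_congr rfl fun i hi => Finset.sum_congr rfl (hR i hi)]
  have e1 : ∀ (s : Finset ℤ) (F : ℤ → ℤ → ℤ → ℤ → A),
      ∑ p ∈ s, ∑ l ∈ s, ∑ i ∈ s, ∑ j ∈ s, F p l i j =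
      ∑ i ∈ s, ∑ j ∈ s, ∑ l ∈ s, ∑ p ∈ s, F p l i j := by
    intro s F
    calc _ = ∑ p ∈ s, ∑ i ∈ s, ∑ j ∈ s, ∑ l ∈ s, F p l i j := by
          refine Finset.sum_congr rfl fun p _ => ?_
          rw [Finset.sum_comm]
          exact Finset.sum_congr rfl fun i _ => Finset.sum_comm
      _ = ∑ i ∈ s, ∑ j ∈ s, ∑ p ∈ s, ∑ l ∈ s, F p l i j := by
          rw [Finset.sum_comm]
          exact Finset.sum_congr rfl fun i _ => Finset.sum_comm
      _ = _ := Finset.sum_congr rfl fun i _ => Finset.sum_congr rfl fun j _ => Finset.sum_comm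
  have e2 : ∀ (s : Finset ℤ) (F : ℤ → ℤ → ℤ → ℤ → A),
      ∑ i ∈ s, ∑ q ∈ s, ∑ j ∈ s, ∑ l ∈ s, F i q j l =
      ∑ i ∈ s, ∑ j ∈ s, ∑ l ∈ s, ∑ q ∈ s, F i q j l := by
    intro s F
    refine Finset.sum_congr rfl fun i _ => ?_
    rw [Finset.sum_comm]
    exact Finset.sum_congr rfl fun j _ => Finset.sum_comm
  refine (e1 _ (fun p l i j => mulTerm d n p l (mulTerm d p i j (f.coeff i) (g.coeff j))
    (h.coeff l))).trans (Eq.trans ?_ (e2 _ (fun i q j l => mulTerm d n i q (f.coeff i)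
    (mulTerm d q j l (g.coeff j) (h.coeff l)))).symm)
  refine Finset.sum_congr rfl fun i _ => Finset.sum_congr rfl fun j _ =>
    Finset.sum_congr rfl fun l _ => ?_
  by_cases hi : a < i
  · simp only [ha i hi, mulTerm_zero_left]
  by_cases hj : b < j
  · simp only [hb j hj, mulTerm_zero_left, mulTerm_zero_right]
  by_cases hl : c < l
  · simp only [hc l hl, mulTerm_zero_right]
  exact mulTerm_assoc _ _ _ i j l n M (by omega) (by omega) (by omega) (by omega)

instance : One (PseudoDiff A d) :=
  ⟨⟨fun n => if n = 0 then 1 else 0, 0, fun _ hn => if_neg (ne_of_gt hn)⟩⟩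

theorem coeff_one (n : ℤ) : (1 : PseudoDiff A d).coeff n = if n = 0 then 1 else 0 := rfl

protected theorem one_mul (f : PseudoDiff A d) : 1 * f = f := by
  ext n
  rw [coeff_mul, finsum_eq_single _ (0, n)]
  · simp [mulTerm, coeff_one]
  · rintro ⟨i, j⟩ hp
    by_cases hi : i = 0
    · subst hi
      have hj : j ≠ n := fun h => hp (by rw [h])
      by_cases hn : 0 + j < n
      · exact mulTerm_of_lt hn _ _
      · simp only [mulTerm]
        rw [if_pos (by omega), Ring.choose_zero_pos ℤ (by omega), zero_smul]
    · simp only [coeff_one, if_neg hi, mulTerm_zero_left]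

protected theorem mul_one (f : PseudoDiff A d) : f * 1 = f := by
  ext n
  rw [coeff_mul, finsum_eq_single _ (n, 0)]
  · simp [mulTerm, coeff_one]
  · rintro ⟨i, j⟩ hp
    by_cases hj : j = 0
    · subst hj
      have hi : i ≠ n := fun h => hp (by rw [h])
      by_cases hn : i + 0 < n
      · exact mulTerm_of_lt hn _ _
      · simp only [mulTerm]
        rw [if_pos (by omega), coeff_one, if_pos rfl, RingDeriv.iter_one d (by omega), mul_zero,
          smul_zero]
    · simp only [coeff_one, if_neg hj, mulTerm_zero_right]

protected theorem left_distrib (f g h : PseudoDiff A d) : f * (g + h) = f * g + f * h := by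
  ext n
  obtain ⟨a, ha⟩ := f.bdd
  obtain ⟨b, hb, hc⟩ := bdd₂ g h
  have hbc : ∀ j, b < j → (g + h).coeff j = 0 := fun j hj => by
    rw [coeff_add, hb j hj, hc j hj, add_zero]
  obtain ⟨M, hM⟩ : ∃ M : ℤ, M = |a| + |b| + |n| := ⟨_, rfl⟩
  have a1 := le_abs_self a
  have a2 := abs_nonneg a
  have b1 := le_abs_self b
  have b2 := abs_nonneg b
  have n1 := neg_abs_le n
  have n2 := abs_nonneg n
  rw [coeff_add, coeff_mul_eq_sum (M := M) ha hbc, coeff_mul_eq_sum (M := M) ha hb,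
    coeff_mul_eq_sum (M := M) ha hc]
  · simp only [coeff_add, mulTerm_add_right, Finset.sum_add_distrib]
  all_goals omega

protected theorem right_distrib (f g h : PseudoDiff A d) : (f + g) * h = f * h + g * h := by
  ext n
  obtain ⟨a, ha⟩ := h.bdd
  obtain ⟨b, hb, hc⟩ := bdd₂ f g
  have hbc : ∀ j, b < j → (f + g).coeff j = 0 := fun j hj => by
    rw [coeff_add, hb j hj, hc j hj, add_zero]
  obtain ⟨M, hM⟩ : ∃ M : ℤ, M = |a| + |b| + |n| := ⟨_, rfl⟩
  have a1 := le_abs_self a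
  have a2 := abs_nonneg a
  have b1 := le_abs_self b
  have b2 := abs_nonneg b
  have n1 := neg_abs_le n
  have n2 := abs_nonneg n
  rw [coeff_add, coeff_mul_eq_sum (M := M) hbc ha, coeff_mul_eq_sum (M := M) hb ha,
    coeff_mul_eq_sum (M := M) hc ha]
  · simp only [coeff_add, mulTerm_add_left, Finset.sum_add_distrib]
  all_goals omega

protected theorem zero_mul (f : PseudoDiff A d) : 0 * f = 0 := by
  have h := PseudoDiff.right_distrib 0 0 f
  rw [add_zero] at h
  exact left_eq_add.1 h

protected theorem mul_zero (f : PseudoDiff A d) : f * 0 = 0 := by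
  have h := PseudoDiff.left_distrib f 0 0
  rw [add_zero] at h
  exact left_eq_add.1 h

noncomputable instance : Ring (PseudoDiff A d) where
  __ := (inferInstance : AddCommGroup (PseudoDiff A d))
  mul_assoc := PseudoDiff.mul_assoc
  one_mul := PseudoDiff.one_mul
  mul_one := PseudoDiff.mul_one
  left_distrib := PseudoDiff.left_distrib
  right_distrib := PseudoDiff.right_distrib
  zero_mul := PseudoDiff.zero_mul
  mul_zero := PseudoDiff.mul_zero
  zsmul_neg' := SubNegMonoid.zsmul_neg'
  neg_add_cancel := neg_add_cancel

/-- A derivation `e` of `A` that commutes with `d` acts on `A((∂⁻¹))` coefficientwise. -/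
def mapDeriv (d e : RingDeriv A) (h : ∀ a, d (e a) = e (d a)) : RingDeriv (PseudoDiff A d) where
  toFun f := ⟨fun n => e (f.coeff n), by
    obtain ⟨a, ha⟩ := f.bdd
    exact ⟨a, fun n hn => by rw [ha n hn, map_zero]⟩⟩
  map_zero' := by
    ext n
    exact map_zero e
  map_add' f g := by
    ext n
    exact map_add e _ _
  leibniz' f g := by
    ext n
    obtain ⟨a, ha⟩ := f.bdd
    obtain ⟨b, hb⟩ := g.bdd
    obtain ⟨M, hM⟩ : ∃ M : ℤ, M = |a| + |b| + |n| := ⟨_, rfl⟩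
    have a1 := le_abs_self a
    have a2 := abs_nonneg a
    have b1 := le_abs_self b
    have b2 := abs_nonneg b
    have n1 := neg_abs_le n
    have n2 := abs_nonneg n
    rw [coeff_add, coeff_mul_eq_sum (M := M) (a := a) (b := b),
      coeff_mul_eq_sum (M := M) (a := a) (b := b), ← Finset.sum_add_distrib]
    rotate_left
    · exact ha
    · intro j hj
      simp only [hb j hj, map_zero]
    iterate 4 omega
    · intro j hj
      simp only [ha j hj, map_zero]
    · exact hb
    iterate 4 omega
    simp only
    rw [coeff_mul_eq_sum (M := M) ha hb (by omega) (by omega) (by omega) (by omega), map_sum]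
    refine Finset.sum_congr rfl fun i _ => ?_
    rw [map_sum, ← Finset.sum_add_distrib]
    refine Finset.sum_congr rfl fun j _ => ?_
    unfold mulTerm
    split_ifs
    · rw [map_zsmul, RingDeriv.leibniz, smul_add, RingDeriv.iter_comm d e h]
    · rw [map_zero, add_zero]

end PseudoDiff

section Laurent

variable {R : Type*} [CommRing R]

theorem laurent_coeff_mul (f g : LaurentSeries R) (n : ℤ) (s : Finset ℤ)
    (hs : ∀ i, f.coeff i ≠ 0 → g.coeff (n - i) ≠ 0 → i ∈ s) :
    (f * g).coeff n = ∑ i ∈ s, f.coeff i * g.coeff (n - i) := by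
  rw [HahnSeries.coeff_mul]
  refine Finset.sum_of_injOn (fun p : ℤ × ℤ => p.1) ?_ ?_ ?_ ?_
  · rintro ⟨i, j⟩ h ⟨i', j'⟩ h' e
    simp only [Finset.mem_coe, Finset.mem_antidiagonal] at h h'
    simp only at e
    ext <;> simp <;> omega
  · rintro ⟨i, j⟩ h
    simp only [Finset.mem_coe, Finset.mem_antidiagonal, HahnSeries.mem_support] at h
    obtain ⟨h1, h2, h3⟩ := h
    exact hs i h1 (by rwa [show n - i = j by omega])
  · intro i _ hi
    by_contra h
    have h1 : f.coeff i ≠ 0 := left_ne_zero_of_mul h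
    have h2 : g.coeff (n - i) ≠ 0 := right_ne_zero_of_mul h
    refine hi ⟨(i, n - i), ?_, rfl⟩
    simp only [Finset.mem_coe, Finset.mem_antidiagonal, HahnSeries.mem_support]
    exact ⟨h1, h2, by omega⟩
  · rintro ⟨i, j⟩ h
    simp only [Finset.mem_antidiagonal] at h
    simp only
    rw [show n - i = j by omega]

theorem laurent_exists_finset (f g : LaurentSeries R) (n : ℤ) : ∃ s : Finset ℤ,
    ∀ i, f.coeff i ≠ 0 → g.coeff (n - i) ≠ 0 → i ∈ s := by
  refine ⟨Finset.Icc f.order (n - g.order), fun i h1 h2 => Finset.mem_Icc.2 ⟨?_, ?_⟩⟩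
  · exact HahnSeries.order_le_of_coeff_ne_zero h1
  · have := HahnSeries.order_le_of_coeff_ne_zero h2
    omega

/-- The derivation `d/dx` of `R((x))`. -/
noncomputable def laurentDeriv (R : Type*) [CommRing R] : RingDeriv (LaurentSeries R) where
  toFun f := LaurentSeries.derivative R f
  map_zero' := map_zero _
  map_add' := map_add _
  leibniz' f g := by
    ext n
    obtain ⟨s, hs⟩ := laurent_exists_finset f g (n + 1)
    have h1 : (LaurentSeries.derivative R f * g).coeff n =
        ∑ i ∈ s, ((i : ℤ) • f.coeff i) * g.coeff (n + 1 - i) := by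
      rw [laurent_coeff_mul _ _ n (s.map (Equiv.subRight (1 : ℤ)).toEmbedding), Finset.sum_map]
      · refine Finset.sum_congr rfl fun i _ => ?_
        simp [show n - (i - 1) = n + 1 - i by ring]
      · intro i hi hg
        refine Finset.mem_map.2 ⟨i + 1, hs (i + 1) ?_ ?_, by simp⟩
        · intro h
          exact hi (by simp [h])
        · rwa [show n + 1 - (i + 1) = n - i by ring]
    have h2 : (f * LaurentSeries.derivative R g).coeff n =
        ∑ i ∈ s, f.coeff i * ((n + 1 - i : ℤ) • g.coeff (n + 1 - i)) := by
      rw [laurent_coeff_mul _ _ n s]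
      · refine Finset.sum_congr rfl fun i _ => ?_
        simp [show n - i + 1 = n + 1 - i by ring]
      · intro i hi hg
        refine hs i hi fun h => hg ?_
        simp [show n - i + 1 = n + 1 - i by ring, h]
    rw [HahnSeries.coeff_add, h1, h2, ← Finset.sum_add_distrib]
    have h3 : (LaurentSeries.derivative R (f * g)).coeff n = (n + 1) • (f * g).coeff (n + 1) := by
      simp
    rw [h3, laurent_coeff_mul f g (n + 1) s hs, Finset.smul_sum]
    refine Finset.sum_congr rfl fun i _ => ?_
    simp only [zsmul_eq_mul]
    push_cast
    ring

/-- A derivation of `R` acts on `R((x))` coefficientwise. -/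
noncomputable def laurentMap (e : RingDeriv R) : RingDeriv (LaurentSeries R) where
  toFun f := HahnSeries.map f e
  map_zero' := by
    ext n
    simp
  map_add' f g := by
    ext n
    simp
  leibniz' f g := by
    ext n
    obtain ⟨s, hs⟩ := laurent_exists_finset f g n
    rw [HahnSeries.coeff_add, laurent_coeff_mul _ _ n s, laurent_coeff_mul _ _ n s,
      HahnSeries.map_coeff, laurent_coeff_mul f g n s hs, map_sum, ← Finset.sum_add_distrib]
    · exact Finset.sum_congr rfl fun i _ => e.leibniz _ _
    · intro i h1 h2
      refine hs i h1 fun h => h2 ?_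
      simp [h]
    · intro i h1 h2
      refine hs i (fun h => h1 ?_) h2
      simp [h]

theorem laurent_comm (e : RingDeriv R) (f : LaurentSeries R) :
    laurentMap e (laurentDeriv R f) = laurentDeriv R (laurentMap e f) := by
  ext n
  change e ((LaurentSeries.derivative R f).coeff n) =
    (LaurentSeries.derivative R (HahnSeries.map f e)).coeff n
  simp only [LaurentSeries.derivative_apply, LaurentSeries.hasseDeriv_coeff, HahnSeries.map_coeff,
    map_zsmul]

end Laurent

section Two

variable (k : Type*) [Field k]

/-- The field `k((x₁))((x₂))`. -/
abbrev K : Type _ := LaurentSeries (LaurentSeries k)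

/-- The derivation `∂/∂x₁` of `k((x₁))((x₂))`. -/
noncomputable def d₁ : RingDeriv (K k) := laurentMap (laurentDeriv k)

/-- The derivation `∂/∂x₂` of `k((x₁))((x₂))`. -/
noncomputable def d₂ : RingDeriv (K k) := laurentDeriv (LaurentSeries k)

/-- The ring `k((x₁))((x₂))((∂₁⁻¹))`. -/
abbrev Q : Type _ := PseudoDiff (K k) (d₁ k)

/-- The derivation `∂/∂x₂` of `k((x₁))((x₂))((∂₁⁻¹))`; it kills `∂₁`. -/
noncomputable def d₂Q : RingDeriv (Q k) :=
  PseudoDiff.mapDeriv (d₁ k) (d₂ k) (laurent_comm (laurentDeriv k))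

/-- The ring `P = k((x₁))((x₂))((∂₁⁻¹))((∂₂⁻¹))` of formal pseudo-differential operators in two
variables. -/
abbrev P : Type _ := PseudoDiff (Q k) (d₂Q k)

end Two

variable {k : Type*} [Field k]

/-- The index of a coefficient of an operator: the monomial `x₁^i₁ x₂^i₂ ∂₁^j₁ ∂₂^j₂`. -/
structure Expo where
  i₁ : ℤ
  i₂ : ℤ
  j₁ : ℤ
  j₂ : ℤ

/-- The coefficient of `L` at the monomial `x₁^i₁ x₂^i₂ ∂₁^j₁ ∂₂^j₂`. -/
noncomputable def P.entry (L : P k) (e : Expo) : k :=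
  (((L.coeff e.j₂).coeff e.j₁).coeff e.i₂).coeff e.i₁

/-- The residue of an operator: its coefficient at `x₁⁻¹ x₂⁻¹ ∂₁⁻¹ ∂₂⁻¹`. -/
noncomputable def res (L : P k) : k := P.entry L ⟨-1, -1, -1, -1⟩

/-- The part `L₊` of `L` with the nonnegative powers of `∂₂`. -/
noncomputable def plus (L : P k) : P k where
  coeff n := if 0 ≤ n then L.coeff n else 0
  bdd := by
    obtain ⟨a, ha⟩ := L.bdd
    exact ⟨a, fun n hn => by rw [ha n hn, ite_self]⟩

/-- The part `L₋` of `L` with the negative powers of `∂₂`. -/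
noncomputable def minus (L : P k) : P k := L - plus L

/-- The phase space `P²`. -/
abbrev P2 (k : Type*) [Field k] : Type _ := Fin 2 → P k

/-- The subvariety `P'` of pairs of commuting operators. -/
def PPrime (k : Type*) [Field k] : Set (P2 k) := {L | ∀ i j, ⁅L i, L j⁆ = 0}

/-- A vector `X` is tangent to `P'` at the point `L` of `P'`: the operators `Lᵢ + ε Xᵢ` commute
up to `ε²`. -/
def IsTangent (L X : P2 k) : Prop := ∀ i j, ⁅X i, L j⁆ + ⁅L i, X j⁆ = 0

/-- The pairing `⟨L, M⟩ = ∑ᵢ res (Lᵢ Mᵢ)` on `P²`. -/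
noncomputable def pair (L M : P2 k) : k := ∑ i, res (L i * M i)

/-- The bracket `[X, Y]_R = [X₊, Y₊] - [X₋, Y₋]` on `P²`, taken componentwise. -/
noncomputable def bracketR (X Y : P2 k) : P2 k :=
  fun i => ⁅plus (X i), plus (Y i)⁆ - ⁅minus (X i), minus (Y i)⁆

/-- The value at `L` of a monomial in the coefficients of `L₁, L₂`. -/
noncomputable def monomialValue (μ : Fin 2 × Expo →₀ ℕ) (L : P2 k) : k :=
  μ.prod fun v e => P.entry (L v.1) v.2 ^ e

/-- The space `𝓕(P²)` of functionals: functions on `P²` that are polynomials, of bounded degree,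
in any number (possibly infinite) of coefficients of `L₁, L₂`. Each such polynomial is a formal
linear combination of monomials in the coefficients, only finitely many of which are nonzero at
any given point. -/
def Functionals (k : Type*) [Field k] : Set (P2 k → k) :=
  {F | ∃ (c : (Fin 2 × Expo →₀ ℕ) → k) (D : ℕ), (∀ μ, c μ ≠ 0 → μ.degree ≤ D) ∧
    ∀ L, (Function.support fun μ => c μ * monomialValue μ L).Finite ∧
      F L = ∑ᶠ μ, c μ * monomialValue μ L}

/-- `F` has the derivative `v` at `L` in the direction `M`, that is, `F (L + ε M)` is a polynomial
in `ε` and its derivative at `ε = 0` is `v`. -/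
def HasDirDeriv (F : P2 k → k) (L M : P2 k) (v : k) : Prop :=
  ∃ p : Polynomial k, (∀ ε : k, F (L + ε • M) = p.eval ε) ∧ p.derivative.eval 0 = v

/-- `U` is the gradient of `F` at `L`: `⟨M, U⟩` is the derivative of `F` in the direction `M`, for
all `M`. -/
def IsGradient (F : P2 k → k) (L U : P2 k) : Prop := ∀ M, HasDirDeriv F L M (pair M U)

/-- The gradient of `F` at `L`. -/
noncomputable def grad (F : P2 k → k) (L : P2 k) : P2 k := Classical.epsilon (IsGradient F L)

/-- The Poisson bracket `{F, G}_R (L) = ⟨L, [∇F(L), ∇G(L)]_R⟩`. -/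
noncomputable def poissonR (F G : P2 k → k) : P2 k → k :=
  fun L => pair L (bracketR (grad F L) (grad G L))

/-- `H_{a,b}(L) = res (L₁ᵃ L₂ᵇ)`. -/
noncomputable def H₂ (a b : ℕ) (L : P2 k) : k := res (L 0 ^ a * L 1 ^ b)

/-- `H_m = (1/m) ∑_{a+b=m} binom(m, a) H_{a,b}`. -/
noncomputable def H (m : ℕ) (L : P2 k) : k :=
  (1 / (m : k)) * ∑ p ∈ Finset.HasAntidiagonal.antidiagonal m, (m.choose p.1 : k) * H₂ p.1 p.2 L

/-- The right-hand side `[((L₁ + L₂)^{m-1})₊, Lᵢ]` of the Lax equations. -/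
noncomputable def lax (m : ℕ) (L : P2 k) : P2 k :=
  fun i => ⁅plus ((L 0 + L 1) ^ (m - 1)), L i⁆

section Time

variable {S : Type*}

/-- The partial derivative of a formal power series in the times `tₛ` with respect to `tₛ`. -/
noncomputable def timeDeriv {R : Type*} [Semiring R] (s : S) (f : MvPowerSeries S R) :
    MvPowerSeries S R :=
  fun n => (n s + 1) • MvPowerSeries.coeff (n + Finsupp.single s 1) f

/-- The part `L₊` of an operator that depends on the times. -/
noncomputable def plusT (f : MvPowerSeries S (P k)) : MvPowerSeries S (P k) :=
  fun n => plus (MvPowerSeries.coeff n f)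

open Classical in
/-- The value `∑_{j ≤ n} ε^j Lⱼ` at `t = ε` of the truncation of a formal curve `L(t) = ∑ tʲ Lⱼ` in
`P²`. -/
noncomputable def truncAt (L : Fin 2 → MvPowerSeries S (P k)) (n : S →₀ ℕ) (ε : S → k) : P2 k :=
  fun i => ∑ j ∈ Finset.Icc 0 n, (j.prod fun s e => ε s ^ e) • MvPowerSeries.coeff j (L i)

/-- The formal power series `f(t)` over `k` is the value `F(L(t))` of `F` on the formal curve
`L(t)` in `P²`: the coefficient of `f` at `tⁿ` is that of `F` on the truncation of `L(t)`, which is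
a polynomial in the times. -/
def IsValue (F : P2 k → k) (L : Fin 2 → MvPowerSeries S (P k)) (f : MvPowerSeries S k) : Prop :=
  ∀ n : S →₀ ℕ, ∃ p : MvPolynomial S k, (∀ ε : S → k, F (truncAt L n ε) = MvPolynomial.eval ε p) ∧
    MvPowerSeries.coeff n f = MvPolynomial.coeff n p

/-- The formal curve `L(t)` in `P²` satisfies the Hamiltonian system `∂F/∂tₛ = {F, G}_R` for all
functionals `F`. -/
def IsHamiltonSolution (G : P2 k → k) (s : S) (L : Fin 2 → MvPowerSeries S (P k)) : Prop :=
  ∀ F ∈ Functionals k, ∃ f g : MvPowerSeries S k,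
    IsValue F L f ∧ IsValue (poissonR F G) L g ∧ timeDeriv s f = g

/-- The formal curve `L(t)` lies in `P'`. -/
def InPPrimeT (L : Fin 2 → MvPowerSeries S (P k)) : Prop := ∀ i j, ⁅L i, L j⁆ = 0

/-- The formal curve `L(t)` satisfies `∂Lᵢ/∂tₛ = [((L₁ + L₂)^{m-1})₊, Lᵢ]` for all `i`. -/
def IsLaxSolution (m : ℕ) (s : S) (L : Fin 2 → MvPowerSeries S (P k)) : Prop :=
  ∀ i, timeDeriv s (L i) = ⁅plusT ((L 0 + L 1) ^ (m - 1)), L i⁆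

end Time

end PDO

/-!
The residue is a trace on `P`, and the pairing it defines is nondegenerate with `P₊` orthogonal to
`P₊` and `P₋` to `P₋`. Hence a functional has at most one gradient; it has one because monomials in
the coefficients of an operator are residues against monomial operators, and the finiteness
condition, tested at generic points, makes the resulting formal sum of monomial operators an
element of `P`. The gradient of `H_m` is `1/m` times the cyclic derivative of
`∑ binom(m, a) x₀ᵃ x₁ᵇ`. Moving the projections `±` across the residue turns `{F, H_m}_R` into the
derivative of `F` along a vector field, and where `L₀` and `L₁` commute both components of the
gradient are `(L₀ + L₁) ^ (m - 1)`, so the vector field is the Lax field `[W, Lᵢ]` with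
`W = ((L₀ + L₁) ^ (m - 1))₊`.

Along a Lax field every noncommutative polynomial `p` in `L₀, L₁` evolves by `[W, p]`. Applied to
the commutator, this gives the invariance of `P'`; the traces `H_m` are constant since the residue
of a commutator vanishes. A formal solution that starts in `P'` is treated by induction on the
degree: if `[L₀, L₁]` vanishes to some order then `L` is a Lax solution to that order, so that the
time derivatives of `[L₀, L₁]` vanish to that order too. The functionals are only defined at points
of `P²`, so their values on a power series are computed on its truncations, which are polynomials
in the times and can be evaluated.
-/

namespace PDO

namespace RingDeriv

variable {A : Type*} [Ring A]

theorem iter_smul {k : Type*} [SMul k A] (d : RingDeriv A)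
    (hd : ∀ (c : k) (a : A), d (c • a) = c • d a) (n : ℕ) (c : k) (a : A) :
    d^[n] (c • a) = c • d^[n] a := by
  induction n with
  | zero => rfl
  | succ n ih => rw [Function.iterate_succ_apply', Function.iterate_succ_apply', ih, hd]

theorem trace_mul_iterate {B : Type*} [AddCommGroup B] (d : RingDeriv A) (τ : A →+ B)
    (hd : ∀ a, τ (d a) = 0) (n : ℕ) (a b : A) :
    τ (a * d^[n] b) = (-1 : ℤ) ^ n • τ (d^[n] a * b) := by
  induction n generalizing a with
  | zero => simp
  | succ n ih =>
    have h := hd (a * d^[n] b)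
    rw [leibniz, map_add, ← Function.iterate_succ_apply' d, ih (d a),
      ← Function.iterate_succ_apply d] at h
    rw [eq_neg_of_add_eq_zero_right h, pow_succ, mul_neg_one, neg_smul]

end RingDeriv

namespace PseudoDiff

/-- The operator `f` has order at most `a`: no power of `∂` above `∂ᵃ` occurs in it. -/
def OrderLE {A : Type*} [Ring A] {d : RingDeriv A} (f : PseudoDiff A d) (a : ℤ) : Prop :=
  ∀ n, a < n → f.coeff n = 0

section Basic

variable {A : Type*} [Ring A] {d : RingDeriv A}

theorem OrderLE.le_of_coeff_ne_zero {f : PseudoDiff A d} {a n : ℤ} (hf : f.OrderLE a)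
    (h : f.coeff n ≠ 0) : n ≤ a :=
  not_lt.1 fun hn => h (hf n hn)

theorem OrderLE.mul {f g : PseudoDiff A d} {a b : ℤ} (hf : f.OrderLE a) (hg : g.OrderLE b) :
    (f * g).OrderLE (a + b) := fun _ => coeff_mul_of_lt hf hg

theorem OrderLE.smul {k : Type*} [SMulZeroClass k A] {f : PseudoDiff A d} {a : ℤ}
    (hf : f.OrderLE a) (c : k) : (c • f).OrderLE a := fun n hn => by
  rw [coeff_smul, hf n hn, smul_zero]

theorem exists_coeff_mul_eq_sum (d : RingDeriv A) (a b n : ℤ) : ∃ M : ℤ,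
    ∀ f g : PseudoDiff A d, f.OrderLE a → g.OrderLE b → (f * g).coeff n =
      ∑ i ∈ Finset.Icc (-M) M, ∑ j ∈ Finset.Icc (-M) M,
        mulTerm d n i j (f.coeff i) (g.coeff j) := by
  have ha := abs_nonneg a
  have hb := abs_nonneg b
  have hn := abs_nonneg n
  have ha' := le_abs_self a
  have hb' := le_abs_self b
  have hn' := neg_abs_le n
  exact ⟨|a| + |b| + |n|, fun f g hf hg =>
    coeff_mul_eq_sum hf hg (by omega) (by omega) (by omega) (by omega)⟩

theorem mulTerm_eq_zero_of_forall_coeff {n i j : ℤ} {x : A} {g : PseudoDiff A d} {b : ℤ}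
    (hg : g.OrderLE b) (h : j ∉ Set.Icc (n - i) b) : mulTerm d n i j x (g.coeff j) = 0 := by
  rw [Set.mem_Icc, not_and_or, not_le, not_le] at h
  rcases h with h | h
  · exact mulTerm_of_lt (by omega) _ _
  · rw [hg j h, mulTerm_zero_right]

end Basic

section Smul

variable {k A : Type*} [Ring A] [Semiring k] [Module k A] {d : RingDeriv A}

theorem mulTerm_smul_left [IsScalarTower k A A] (n i j : ℤ) (c : k) (x y : A) :
    mulTerm d n i j (c • x) y = c • mulTerm d n i j x y := by
  simp only [mulTerm, smul_mul_assoc, smul_ite, smul_zero, smul_comm _ c]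

theorem mulTerm_smul_right [SMulCommClass k A A] (hd : ∀ (c : k) (a : A), d (c • a) = c • d a)
    (n i j : ℤ) (c : k) (x y : A) : mulTerm d n i j x (c • y) = c • mulTerm d n i j x y := by
  simp only [mulTerm, d.iter_smul hd, mul_smul_comm, smul_ite, smul_zero, smul_comm _ c]

protected theorem smul_mul [IsScalarTower k A A] (c : k) (f g : PseudoDiff A d) :
    c • f * g = c • (f * g) := by
  ext n
  obtain ⟨a, ha⟩ := f.bdd
  obtain ⟨b, hb⟩ := g.bdd
  obtain ⟨M, hM⟩ := exists_coeff_mul_eq_sum d a b n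
  rw [coeff_smul, hM _ _ (OrderLE.smul ha c) hb, hM _ _ ha hb]
  simp only [coeff_smul, mulTerm_smul_left, Finset.smul_sum]

protected theorem mul_smul [SMulCommClass k A A] (hd : ∀ (c : k) (a : A), d (c • a) = c • d a)
    (c : k) (f g : PseudoDiff A d) : f * c • g = c • (f * g) := by
  ext n
  obtain ⟨a, ha⟩ := f.bdd
  obtain ⟨b, hb⟩ := g.bdd
  obtain ⟨M, hM⟩ := exists_coeff_mul_eq_sum d a b n
  rw [coeff_smul, hM _ _ ha (OrderLE.smul hb c), hM _ _ ha hb]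
  simp only [coeff_smul, mulTerm_smul_right hd, Finset.smul_sum]

end Smul

section Trace

variable {A B : Type*} [Ring A] [AddCommGroup B] {d : RingDeriv A} {τ : A →+ B}

theorem trace_mulTerm_comm (hτ : ∀ a b, τ (a * b) = τ (b * a)) (hd : ∀ a, τ (d a) = 0)
    (i j : ℤ) (x y : A) : τ (mulTerm d (-1) i j x y) = τ (mulTerm d (-1) j i y x) := by
  by_cases h : i + j < -1
  · rw [mulTerm_of_lt h, mulTerm_of_lt (by omega)]
  obtain ⟨N, hN⟩ := Int.eq_ofNat_of_zero_le (show 0 ≤ i + j - -1 by omega)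
  have choose_symm : Ring.choose i N * (-1) ^ N = Ring.choose j N := by
    rw [show i = -(j - N + 1) by omega, Ring.choose_neg,
      show j - (N : ℤ) + 1 + N - 1 = j by ring, Int.negOnePow_def]
    simp only [Units.smul_def, smul_eq_mul, zpow_natCast, Units.val_pow_eq_pow_val, Units.val_neg,
      Units.val_one]
    rw [mul_right_comm, ← mul_pow, neg_one_mul, neg_neg, one_pow, one_mul]
  unfold mulTerm
  rw [if_pos (by omega), if_pos (by omega), add_comm j i, hN, Int.toNat_natCast, map_zsmul,
    map_zsmul, d.trace_mul_iterate τ hd, hτ _ y, smul_smul, choose_symm]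

theorem trace_mul_comm (hτ : ∀ a b, τ (a * b) = τ (b * a)) (hd : ∀ a, τ (d a) = 0)
    (f g : PseudoDiff A d) : τ ((f * g).coeff (-1)) = τ ((g * f).coeff (-1)) := by
  obtain ⟨a, hf, hg⟩ := bdd₂ f g
  obtain ⟨M, hM⟩ := exists_coeff_mul_eq_sum d a a (-1)
  rw [hM f g hf hg, hM g f hg hf, Finset.sum_comm]
  simp only [map_sum, trace_mulTerm_comm hτ hd]

end Trace

section Single

variable {A : Type*} [Ring A] {d : RingDeriv A}

/-- The operator `a ∂ᵐ`, the building block of all pseudo-differential operators. -/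
def single (m : ℤ) (a : A) : PseudoDiff A d where
  coeff n := if n = m then a else 0
  bdd := ⟨m, fun _ hn => if_neg (ne_of_gt hn)⟩

theorem coeff_single (m n : ℤ) (a : A) :
    (single m a : PseudoDiff A d).coeff n = if n = m then a else 0 := rfl

theorem coeff_single_mul (m n : ℤ) (a : A) (g : PseudoDiff A d) :
    (single m a * g).coeff n = ∑ᶠ j : ℤ, mulTerm d n m j a (g.coeff j) := by
  rw [coeff_mul, ← finsum_mem_univ,
    finsum_mem_inter_support_eq' _ Set.univ (Set.range (Prod.mk m)) ?_,
    finsum_mem_range (Prod.mk_right_injective m)]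
  · simp only [coeff_single, if_true]
  · rintro ⟨i, j⟩ hp
    refine iff_of_true trivial ⟨j, ?_⟩
    by_contra h
    have hi : i ≠ m := fun hi => h (by rw [hi])
    exact hp (by simp only [coeff_single, if_neg hi, mulTerm_zero_left])

theorem coeff_neg_one_single_mul {g : PseudoDiff A d} {b : ℤ} (hg : g.OrderLE b) (m : ℤ) (a : A)
    {R : ℕ} (hR : b + m + 1 < R) : (single m a * g).coeff (-1) =
      ∑ r ∈ Finset.range R, Ring.choose m r • (a * d^[r] (g.coeff (r - 1 - m))) := by
  have hinj : Function.Injective fun r : ℕ => (r : ℤ) - 1 - m := fun r s h => by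
    simp only at h
    omega
  rw [coeff_single_mul, finsum_eq_sum_of_support_subset
    (s := (Finset.range R).image fun r : ℕ => (r : ℤ) - 1 - m), Finset.sum_image hinj.injOn]
  · refine Finset.sum_congr rfl fun r _ => ?_
    rw [mulTerm, if_pos (by omega), show (m + ((r : ℤ) - 1 - m) - -1).toNat = r by omega]
  · intro j hj
    have hj' : j ∈ Set.Icc (-1 - m) b := by
      by_contra h
      exact hj (mulTerm_eq_zero_of_forall_coeff hg h)
    simp only [Finset.coe_image, Finset.coe_range, Set.mem_image, Set.mem_Iio]
    exact ⟨(m + j + 1).toNat, by grind, by grind⟩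

theorem eq_zero_of_trace_mul_eq_zero {B : Type*} [AddCommGroup B] {τ : A →+ B}
    (hτ : ∀ b, (∀ a, τ (a * b) = 0) → b = 0) (g : PseudoDiff A d)
    (hg : ∀ f : PseudoDiff A d, τ ((f * g).coeff (-1)) = 0) : g = 0 := by
  by_contra! hne
  obtain ⟨b, hb⟩ := g.bdd
  obtain ⟨l, hl, hmax⟩ := Int.exists_greatest_of_bdd (P := fun n => g.coeff n ≠ 0)
    ⟨b, fun _ => OrderLE.le_of_coeff_ne_zero hb⟩ (by
      contrapose! hne
      exact ext hne)
  have hl' : g.OrderLE l := fun n hn => by_contra fun h => (hmax n h).not_gt hn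
  refine hl (hτ _ fun a => ?_)
  have htop := hg (single (-1 - l) a)
  rw [coeff_neg_one_single_mul hl' _ a (R := 1) (by push_cast; omega)] at htop
  simpa using htop

end Single

section OfRight

variable {A : Type*} [Ring A] {d : RingDeriv A}

/-- The operator `∑ ∂ˡ bₗ`, where `b = ∑ bₗ ∂ˡ`: the coefficients of `b` are moved to the right
of the powers of `∂`. -/
noncomputable def ofRight (b : PseudoDiff A d) : PseudoDiff A d where
  coeff n := ∑ᶠ s : ℕ, Ring.choose (n + s) s • d^[s] (b.coeff (n + s))
  bdd := by
    obtain ⟨N, hN⟩ := b.bdd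
    refine ⟨N, fun n hn => finsum_eq_zero_of_forall_eq_zero fun s => ?_⟩
    rw [hN _ (by omega), RingDeriv.iter_zero, smul_zero]

theorem coeff_ofRight {b : PseudoDiff A d} {N : ℤ} (hb : b.OrderLE N) (n : ℤ) {R : ℕ}
    (hR : N < n + R) : (ofRight b).coeff n =
      ∑ s ∈ Finset.range R, Ring.choose (n + s) s • d^[s] (b.coeff (n + s)) := by
  refine finsum_eq_sum_of_support_subset _ fun s hs => ?_
  rw [Finset.coe_range, Set.mem_Iio]
  by_contra h
  exact hs (by simp only [hb (n + s) (by omega), RingDeriv.iter_zero, smul_zero])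

theorem OrderLE.ofRight {b : PseudoDiff A d} {N : ℤ} (hb : b.OrderLE N) :
    (ofRight b).OrderLE N := fun n hn => by
  rw [coeff_ofRight hb n (R := 0) (by simpa using hn), Finset.range_zero, Finset.sum_empty]

theorem ofRight_zero : ofRight (0 : PseudoDiff A d) = 0 :=
  ext fun n => OrderLE.ofRight (N := n - 1) (fun _ _ => rfl) n (by omega)

theorem sum_choose_mul_choose_sub (m : ℤ) (n : ℕ) :
    ∑ r ∈ Finset.range (n + 1), Ring.choose m r * Ring.choose ((n : ℤ) - 1 - m) (n - r) =
      if n = 0 then 1 else 0 := by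
  rw [← Finset.Nat.sum_antidiagonal_eq_sum_range_succ
      (fun r s => Ring.choose m r * Ring.choose ((n : ℤ) - 1 - m) s),
    ← Ring.add_choose_eq n (Commute.all m _), show m + ((n : ℤ) - 1 - m) = n - 1 by ring]
  rcases n with _ | n
  · simp
  · rw [if_neg n.succ_ne_zero, Nat.cast_succ, add_sub_cancel_right, Ring.choose_natCast,
      Nat.choose_succ_self, Nat.cast_zero]

theorem coeff_neg_one_single_mul_ofRight (b : PseudoDiff A d) (m : ℤ) (a : A) :
    (single m a * ofRight b).coeff (-1) = a * b.coeff (-1 - m) := by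
  obtain ⟨N, hN⟩ := b.bdd
  obtain ⟨R, hR⟩ : ∃ R : ℕ, N + m + 1 < R ∧ 0 < R := ⟨(N + m + 2).toNat + 1, by omega⟩
  let t (r s : ℕ) : A := (Ring.choose m r * Ring.choose ((r + s : ℕ) - 1 - m) s) •
    (a * d^[r + s] (b.coeff ((r + s : ℕ) - 1 - m)))
  calc (single m a * ofRight b).coeff (-1)
      = ∑ r ∈ Finset.range R, ∑ s ∈ Finset.range (R - r), t r s := by
        rw [coeff_neg_one_single_mul (OrderLE.ofRight hN) m a hR.1]
        refine Finset.sum_congr rfl fun r hr => ?_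
        rw [Finset.mem_range] at hr
        rw [coeff_ofRight hN _ (R := R - r) (by omega), RingDeriv.iter_sum, Finset.mul_sum,
          Finset.smul_sum]
        refine Finset.sum_congr rfl fun s _ => ?_
        rw [RingDeriv.iter_zsmul, mul_smul_comm, smul_smul, ← Function.iterate_add_apply,
          show (r : ℤ) - 1 - m + s = (r + s : ℕ) - 1 - m by push_cast; ring]
    _ = ∑ n ∈ Finset.range R, ∑ r ∈ Finset.range (n + 1), t r (n - r) :=
        (Finset.sum_range_diag_flip R t).symm
    _ = ∑ n ∈ Finset.range R, if n = 0 then a * b.coeff (-1 - m) else 0 := by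
        refine Finset.sum_congr rfl fun n _ => ?_
        have hn : ∀ r ∈ Finset.range (n + 1), t r (n - r) =
            (Ring.choose m r * Ring.choose ((n : ℤ) - 1 - m) (n - r)) •
              (a * d^[n] (b.coeff (n - 1 - m))) := fun r hr => by
          simp only [t, Nat.add_sub_cancel' (Finset.mem_range_succ_iff.1 hr)]
        rw [Finset.sum_congr rfl hn, ← Finset.sum_smul, sum_choose_mul_choose_sub]
        rcases n with _ | n <;> simp
    _ = a * b.coeff (-1 - m) := by
        rw [Finset.sum_ite_eq', if_pos (Finset.mem_range.2 hR.2)]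

end OfRight

end PseudoDiff

/-- A notion of formal summation of infinite families in a ring, compatible with the ring
operations. Algebraic rules take the place of a topology, for which the multiplication of
iterated Laurent series would not be continuous. -/
structure FormalSum (A : Type*) [Ring A] where
  /-- The family `f` is summable with sum `a`. -/
  HasSum : ∀ {I : Type}, (I → A) → A → Prop
  zero : ∀ {I : Type}, HasSum (fun _ : I => 0) 0
  unit : ∀ a, HasSum (fun _ : Unit => a) a
  add : ∀ {I : Type} {f g : I → A} {a b : A}, HasSum f a → HasSum g b →
    HasSum (fun i => f i + g i) (a + b)
  zsmul : ∀ {I : Type} {f : I → A} {a : A} (z : ℤ), HasSum f a → HasSum (fun i => z • f i) (z • a)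
  mul : ∀ {I J : Type} {f : I → A} {g : J → A} {a b : A}, HasSum f a → HasSum g b →
    HasSum (fun p : I × J => f p.1 * g p.2) (a * b)

namespace FormalSum

section Ring

variable {A : Type*} [Ring A]

theorem sum (S : FormalSum A) {I κ : Type} (s : Finset κ) {f : κ → I → A} {a : κ → A}
    (h : ∀ j ∈ s, S.HasSum (f j) (a j)) :
    S.HasSum (fun i => ∑ j ∈ s, f j i) (∑ j ∈ s, a j) := by
  classical
  induction s using Finset.induction_on with
  | empty => simpa using S.zero
  | insert j s hj ih =>
    simp only [Finset.sum_insert hj]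
    exact S.add (h j (Finset.mem_insert_self _ _))
      (ih fun i hi => h i (Finset.mem_insert_of_mem hi))

/-- A derivation is compatible with formal sums: it may be applied to them term by term. -/
def Compatible (S : FormalSum A) (d : RingDeriv A) : Prop :=
  ∀ {I : Type} {f : I → A} {a : A}, S.HasSum f a → S.HasSum (fun i => d (f i)) (d a)

theorem Compatible.iterate {S : FormalSum A} {d : RingDeriv A} (hd : S.Compatible d) (n : ℕ)
    {I : Type} {f : I → A} {a : A} (h : S.HasSum f a) :
    S.HasSum (fun i => d^[n] (f i)) (d^[n] a) := by
  induction n with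
  | zero => exact h
  | succ n ih =>
    simp only [Function.iterate_succ_apply']
    exact hd ih

theorem Compatible.mulTerm {S : FormalSum A} {d : RingDeriv A} (hd : S.Compatible d) (n i j : ℤ)
    {I J : Type} {f : I → A} {g : J → A} {a b : A} (hf : S.HasSum f a) (hg : S.HasSum g b) :
    S.HasSum (fun p : I × J => PseudoDiff.mulTerm d n i j (f p.1) (g p.2))
      (PseudoDiff.mulTerm d n i j a b) := by
  unfold PseudoDiff.mulTerm
  split_ifs
  · exact S.zsmul _ (S.mul hf (hd.iterate _ hg))
  · exact S.zero

/-- Summation of families with finitely many nonzero terms. -/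
noncomputable def discrete (A : Type*) [Ring A] : FormalSum A where
  HasSum f a := (Function.support f).Finite ∧ a = ∑ᶠ i, f i
  zero := by simp [Function.support]
  unit a := ⟨Set.toFinite _, by rw [finsum_unique]⟩
  add := by
    rintro I f g a b ⟨hf, rfl⟩ ⟨hg, rfl⟩
    exact ⟨(hf.union hg).subset (Function.support_add f g), (finsum_add_distrib hf hg).symm⟩
  zsmul := by
    rintro I f a z ⟨hf, rfl⟩
    exact ⟨hf.subset (Function.support_const_smul_subset z f), smul_finsum' z hf⟩
  mul := by
    rintro I J f g a b ⟨hf, rfl⟩ ⟨hg, rfl⟩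
    have hs : (Function.support fun p : I × J => f p.1 * g p.2) ⊆
        ↑(hf.toFinset ×ˢ hg.toFinset) := by
      rintro ⟨i, j⟩ h
      simp only [Finset.coe_product, Set.Finite.coe_toFinset]
      exact ⟨left_ne_zero_of_mul h, right_ne_zero_of_mul h⟩
    refine ⟨(Finset.finite_toSet _).subset hs, ?_⟩
    rw [finsum_eq_sum_of_support_subset _ hs, Finset.sum_product,
      finsum_eq_sum_of_support_subset f (s := hf.toFinset) (by simp),
      finsum_eq_sum_of_support_subset g (s := hg.toFinset) (by simp), Finset.sum_mul_sum]

end Ring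

section Laurent

variable {R : Type*} [CommRing R]

theorem laurent_coeff_mul_eq_sum_Icc {f g : LaurentSeries R} {M N : ℤ}
    (hf : ∀ n < M, f.coeff n = 0) (hg : ∀ n < N, g.coeff n = 0) (n : ℤ) :
    (f * g).coeff n = ∑ i ∈ Finset.Icc M (n - N), f.coeff i * g.coeff (n - i) := by
  refine laurent_coeff_mul f g n _ fun i hfi hgi => Finset.mem_Icc.2 ⟨?_, ?_⟩
  · exact not_lt.1 fun h => hfi (hf i h)
  · exact not_lt.1 fun h => hgi (hg _ (by omega))

theorem coeff_laurentDeriv (f : LaurentSeries R) (n : ℤ) :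
    (laurentDeriv R f).coeff n = (n + 1) • f.coeff (n + 1) := by
  change (LaurentSeries.derivative R f).coeff n = _
  simp

theorem coeff_laurentMap (e : RingDeriv R) (f : LaurentSeries R) (n : ℤ) :
    (laurentMap e f).coeff n = e (f.coeff n) := rfl

/-- Coefficientwise summation of families of Laurent series with uniformly bounded order. -/
noncomputable def laurent (S : FormalSum R) : FormalSum (LaurentSeries R) where
  HasSum f a := (∃ N : ℤ, (∀ n < N, a.coeff n = 0) ∧ ∀ i, ∀ n < N, (f i).coeff n = 0) ∧
    ∀ n : ℤ, S.HasSum (fun i => (f i).coeff n) (a.coeff n)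
  zero := ⟨⟨0, fun _ _ => rfl, fun _ _ _ => rfl⟩, fun _ => S.zero⟩
  unit a :=
    have h : ∀ n < a.order, a.coeff n = 0 := fun _ => HahnSeries.coeff_eq_zero_of_lt_order
    ⟨⟨a.order, h, fun _ => h⟩, fun _ => S.unit _⟩
  add := by
    rintro I f g a b ⟨⟨M, ha, hf⟩, hfa⟩ ⟨⟨N, hb, hg⟩, hgb⟩
    refine ⟨⟨min M N, fun n hn => ?_, fun i n hn => ?_⟩, fun n => S.add (hfa n) (hgb n)⟩ <;>
      rw [lt_min_iff] at hn
    · rw [HahnSeries.coeff_add, ha n hn.1, hb n hn.2, add_zero]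
    · rw [HahnSeries.coeff_add, hf i n hn.1, hg i n hn.2, add_zero]
  zsmul := by
    rintro I f a z ⟨⟨M, ha, hf⟩, hfa⟩
    have coeff_zsmul (g : LaurentSeries R) (n : ℤ) : (z • g).coeff n = z • g.coeff n :=
      HahnSeries.coeff_smul ..
    simp only [coeff_zsmul]
    exact ⟨⟨M, fun n hn => by rw [ha n hn, smul_zero], fun i n hn => by rw [hf i n hn, smul_zero]⟩,
      fun n => S.zsmul z (hfa n)⟩
  mul := by
    rintro I J f g a b ⟨⟨M, ha, hf⟩, hfa⟩ ⟨⟨N, hb, hg⟩, hgb⟩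
    refine ⟨⟨M + N, fun n hn => ?_, fun p n hn => ?_⟩, fun n => ?_⟩
    · rw [laurent_coeff_mul_eq_sum_Icc ha hb, Finset.Icc_eq_empty (by omega), Finset.sum_empty]
    · rw [laurent_coeff_mul_eq_sum_Icc (hf p.1) (hg p.2), Finset.Icc_eq_empty (by omega),
        Finset.sum_empty]
    · simp only [laurent_coeff_mul_eq_sum_Icc ha hb, laurent_coeff_mul_eq_sum_Icc (hf _) (hg _)]
      exact S.sum _ fun i _ => S.mul (hfa i) (hgb _)

theorem compatible_laurentDeriv (S : FormalSum R) : S.laurent.Compatible (laurentDeriv R) := by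
  rintro I f a ⟨⟨M, ha, hf⟩, hfa⟩
  refine ⟨⟨M - 1, fun n hn => ?_, fun i n hn => ?_⟩, fun n => ?_⟩
  · rw [coeff_laurentDeriv, ha _ (by omega), smul_zero]
  · rw [coeff_laurentDeriv, hf i _ (by omega), smul_zero]
  · simp only [coeff_laurentDeriv]
    exact S.zsmul _ (hfa _)

theorem Compatible.laurentMap {S : FormalSum R} {e : RingDeriv R} (he : S.Compatible e) :
    S.laurent.Compatible (laurentMap e) := by
  rintro I f a ⟨⟨M, ha, hf⟩, hfa⟩
  refine ⟨⟨M, fun n hn => ?_, fun i n hn => ?_⟩, fun n => he (hfa n)⟩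
  · rw [coeff_laurentMap, ha n hn, map_zero]
  · rw [coeff_laurentMap, hf i n hn, map_zero]

end Laurent

section PseudoDiff

variable {A : Type*} [Ring A] {d : RingDeriv A}

/-- Coefficientwise summation of families of pseudo-differential operators with uniformly bounded
order. -/
noncomputable def pseudoDiff (S : FormalSum A) (hd : S.Compatible d) :
    FormalSum (PseudoDiff A d) where
  HasSum f a := (∃ N : ℤ, a.OrderLE N ∧ ∀ i, (f i).OrderLE N) ∧
    ∀ n : ℤ, S.HasSum (fun i => (f i).coeff n) (a.coeff n)
  zero := ⟨⟨0, fun _ _ => rfl, fun _ _ _ => rfl⟩, fun _ => S.zero⟩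
  unit a := by
    obtain ⟨N, hN⟩ := a.bdd
    exact ⟨⟨N, hN, fun _ => hN⟩, fun n => S.unit _⟩
  add := by
    rintro I f g a b ⟨⟨M, ha, hf⟩, hfa⟩ ⟨⟨N, hb, hg⟩, hgb⟩
    refine ⟨⟨max M N, fun n hn => ?_, fun i n hn => ?_⟩, fun n => S.add (hfa n) (hgb n)⟩ <;>
      rw [max_lt_iff] at hn
    · rw [PseudoDiff.coeff_add, ha n hn.1, hb n hn.2, add_zero]
    · rw [PseudoDiff.coeff_add, hf i n hn.1, hg i n hn.2, add_zero]
  zsmul := by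
    rintro I f a z ⟨⟨M, ha, hf⟩, hfa⟩
    exact ⟨⟨M, ha.smul z, fun i => (hf i).smul z⟩, fun n => S.zsmul z (hfa n)⟩
  mul := by
    rintro I J f g a b ⟨⟨M, ha, hf⟩, hfa⟩ ⟨⟨N, hb, hg⟩, hgb⟩
    refine ⟨⟨M + N, ha.mul hb, fun p => (hf p.1).mul (hg p.2)⟩, fun n => ?_⟩
    obtain ⟨K, hK⟩ := PseudoDiff.exists_coeff_mul_eq_sum d M N n
    simp only [hK _ _ ha hb, hK _ _ (hf _) (hg _)]
    exact S.sum _ fun i _ => S.sum _ fun j _ => hd.mulTerm n i j (hfa i) (hgb j)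

theorem Compatible.mapDeriv {S : FormalSum A} {e : RingDeriv A} (hd : S.Compatible d)
    (he : S.Compatible e) (h : ∀ a, d (e a) = e (d a)) :
    (S.pseudoDiff hd).Compatible (PseudoDiff.mapDeriv d e h) := by
  rintro I f a ⟨⟨M, ha, hf⟩, hfa⟩
  refine ⟨⟨M, fun n hn => ?_, fun i n hn => ?_⟩, fun n => he (hfa n)⟩
  · exact (congrArg e (ha n hn)).trans (map_zero e)
  · exact (congrArg e (hf i n hn)).trans (map_zero e)

end PseudoDiff

end FormalSum

namespace FormalSum

theorem laurent_hasSum_of_coeff_eq_zero {R : Type*} [CommRing R] {S : FormalSum R} {I : Type}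
    {f : I → LaurentSeries R} {a : LaurentSeries R}
    (h₀ : ∀ n, a.coeff n = 0 → ∀ i, (f i).coeff n = 0)
    (h : ∀ n, S.HasSum (fun i => (f i).coeff n) (a.coeff n)) : S.laurent.HasSum f a :=
  have ha : ∀ n < a.order, a.coeff n = 0 := fun _ => HahnSeries.coeff_eq_zero_of_lt_order
  ⟨⟨a.order, ha, fun i n hn => h₀ n (ha n hn) i⟩, h⟩

theorem pseudoDiff_hasSum_of_coeff_eq_zero {A : Type*} [Ring A] {d : RingDeriv A}
    {S : FormalSum A} (hd : S.Compatible d) {I : Type} {f : I → PseudoDiff A d}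
    {a : PseudoDiff A d} (h₀ : ∀ n, a.coeff n = 0 → ∀ i, (f i).coeff n = 0)
    (h : ∀ n, S.HasSum (fun i => (f i).coeff n) (a.coeff n)) : (S.pseudoDiff hd).HasSum f a := by
  obtain ⟨N, hN⟩ := a.bdd
  exact ⟨⟨N, hN, fun i n hn => h₀ n (hN n hn) i⟩, h⟩

end FormalSum

theorem PseudoDiff.coeff_mul_of_forall_neg {A : Type*} [Ring A] {d : RingDeriv A}
    {f g : PseudoDiff A d} (hf : ∀ i < 0, f.coeff i = 0) (hg : ∀ j < 0, g.coeff j = 0) {n : ℤ}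
    (hn : n < 0) : (f * g).coeff n = 0 := by
  rw [PseudoDiff.coeff_mul]
  refine finsum_eq_zero_of_forall_eq_zero fun ⟨i, j⟩ => ?_
  rcases lt_or_ge i 0 with hi | hi
  · simp only [hf i hi, mulTerm_zero_left]
  rcases lt_or_ge j 0 with hj | hj
  · simp only [hg j hj, mulTerm_zero_right]
  lift i to ℕ using hi
  rw [mulTerm, if_pos (by omega), Ring.choose_natCast, Nat.choose_eq_zero_of_lt (by omega),
    Nat.cast_zero, zero_smul]

section Operators

variable (k : Type*) [Field k]

theorem compatible_d₁ : (FormalSum.discrete k).laurent.laurent.Compatible (d₁ k) :=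
  FormalSum.Compatible.laurentMap (FormalSum.compatible_laurentDeriv _)

theorem compatible_d₂ : (FormalSum.discrete k).laurent.laurent.Compatible (d₂ k) :=
  FormalSum.compatible_laurentDeriv _

/-- Formal summation of families of operators in `P`. -/
noncomputable def sumP : FormalSum (P k) :=
  ((FormalSum.discrete k).laurent.laurent.pseudoDiff (compatible_d₁ k)).pseudoDiff
    (FormalSum.Compatible.mapDeriv (compatible_d₁ k) (compatible_d₂ k) _)

variable {k}

theorem d₁_smul (c : k) (f : K k) : d₁ k (c • f) = c • d₁ k f := by
  ext m n
  simp only [d₁, FormalSum.coeff_laurentMap, FormalSum.coeff_laurentDeriv, HahnSeries.coeff_smul,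
    smul_comm _ c]

theorem d₂_smul (c : k) (f : K k) : d₂ k (c • f) = c • d₂ k f := by
  ext m n
  simp only [d₂, FormalSum.coeff_laurentDeriv, HahnSeries.coeff_smul, smul_comm _ c]

theorem d₂Q_smul (c : k) (f : Q k) : d₂Q k (c • f) = c • d₂Q k f :=
  PseudoDiff.ext fun _ => d₂_smul c _

theorem K.C_C_mul (c : k) (f : K k) : HahnSeries.C (HahnSeries.C c) * f = c • f := by
  ext m n
  simp only [HahnSeries.C_mul_eq_smul, HahnSeries.coeff_smul, smul_eq_mul]

instance : IsScalarTower k (K k) (K k) :=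
  ⟨fun c f g => by simp only [smul_eq_mul, ← K.C_C_mul, mul_assoc]⟩

instance : SMulCommClass k (K k) (K k) :=
  ⟨fun c f g => by simp only [smul_eq_mul, ← K.C_C_mul, mul_left_comm]⟩

instance : IsScalarTower k (Q k) (Q k) := ⟨PseudoDiff.smul_mul⟩

instance : SMulCommClass k (Q k) (Q k) := ⟨fun c f g => (PseudoDiff.mul_smul d₁_smul c f g).symm⟩

noncomputable instance : Algebra k (P k) :=
  Algebra.ofModule PseudoDiff.smul_mul (PseudoDiff.mul_smul d₂Q_smul)

/-- The coefficient of an operator at a monomial, as a linear functional. -/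
noncomputable def entryL (e : Expo) : P k →ₗ[k] k where
  toFun L := P.entry L e
  map_add' _ _ := rfl
  map_smul' _ _ := rfl

theorem P.entry_ext {L M : P k} (h : ∀ e, P.entry L e = P.entry M e) : L = M := by
  ext j₂ j₁ i₂ i₁
  exact h ⟨i₁, i₂, j₁, j₂⟩

theorem hasSum_entry {I : Type} {f : I → P k} {a : P k} (h : (sumP k).HasSum f a) (e : Expo) :
    (FormalSum.discrete k).HasSum (fun i => P.entry (f i) e) (P.entry a e) :=
  ((h.2 e.j₂).2 e.j₁).2 e.i₂ |>.2 e.i₁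

/-- The monomial `x₁^i₁ x₂^i₂ ∂₁^j₁ ∂₂^j₂`. -/
noncomputable def P.mono (k : Type*) [Field k] (e : Expo) : P k :=
  PseudoDiff.single e.j₂ <| PseudoDiff.single e.j₁ <|
    HahnSeries.single e.i₂ <| HahnSeries.single e.i₁ 1

open Classical in
theorem P.entry_mono (e e' : Expo) : P.entry (P.mono k e) e' = if e' = e then 1 else 0 := by
  obtain ⟨i₁, i₂, j₁, j₂⟩ := e
  obtain ⟨i₁', i₂', j₁', j₂'⟩ := e'
  by_cases h₁ : j₂' = j₂ <;> by_cases h₂ : j₁' = j₁ <;> by_cases h₃ : i₂' = i₂ <;>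
    by_cases h₄ : i₁' = i₁ <;> simp [P.entry, P.mono, h₁, h₂, h₃, h₄, PseudoDiff.coeff_single]

theorem hasSum_mono (L : P k) : (sumP k).HasSum (fun e => P.entry L e • P.mono k e) L := by
  classical
  have key (j₂ j₁ i₂ i₁ : ℤ) (e : Expo) :
      ((((P.entry L e • P.mono k e).coeff j₂).coeff j₁).coeff i₂).coeff i₁ =
        if e = ⟨i₁, i₂, j₁, j₂⟩ then (((L.coeff j₂).coeff j₁).coeff i₂).coeff i₁ else 0 := by
    change P.entry L e * P.entry (P.mono k e) ⟨i₁, i₂, j₁, j₂⟩ = _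
    rw [P.entry_mono, mul_ite, mul_one, mul_zero]
    exact ite_congr (propext eq_comm) (fun h => h ▸ rfl) fun _ => rfl
  refine FormalSum.pseudoDiff_hasSum_of_coeff_eq_zero
      (FormalSum.Compatible.mapDeriv (compatible_d₁ k) (compatible_d₂ k) _)
      (fun j₂ h e => ?_) fun j₂ =>
    FormalSum.pseudoDiff_hasSum_of_coeff_eq_zero (compatible_d₁ k) (fun j₁ h e => ?_) fun j₁ =>
    FormalSum.laurent_hasSum_of_coeff_eq_zero (fun i₂ h e => ?_) fun i₂ =>
    FormalSum.laurent_hasSum_of_coeff_eq_zero (fun i₁ h e => ?_) fun i₁ => ⟨?_, ?_⟩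
  · ext j₁ i₂ i₁
    rw [key, h]
    exact ite_self 0
  · ext i₂ i₁
    rw [key, h]
    exact ite_self 0
  · ext i₁
    rw [key, h]
    exact ite_self 0
  · rw [key, h, ite_self]
  · refine (Set.finite_singleton (⟨i₁, i₂, j₁, j₂⟩ : Expo)).subset fun e he => ?_
    rw [Function.mem_support, key] at he
    exact (ite_ne_right_iff.1 he).1
  · simp only [key]
    rw [finsum_eq_single _ (⟨i₁, i₂, j₁, j₂⟩ : Expo) fun e he => if_neg he, if_pos rfl]

/-- The residue as a linear functional. -/
noncomputable def resL : P k →ₗ[k] k := entryL ⟨-1, -1, -1, -1⟩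

theorem res_add (L M : P k) : res (L + M) = res L + res M := map_add resL L M

theorem res_sub (L M : P k) : res (L - M) = res L - res M := map_sub resL L M

/-- The residue on `k((x₁))((x₂))`. -/
noncomputable def resK : K k →+ k where
  toFun f := (f.coeff (-1)).coeff (-1)
  map_zero' := rfl
  map_add' _ _ := rfl

/-- The residue on `k((x₁))((x₂))((∂₁⁻¹))`. -/
noncomputable def resQ : Q k →+ k where
  toFun f := resK (f.coeff (-1))
  map_zero' := rfl
  map_add' _ _ := rfl

theorem resK_d₁ (f : K k) : resK (d₁ k f) = 0 := by
  change (laurentDeriv k (f.coeff (-1))).coeff (-1) = 0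
  rw [FormalSum.coeff_laurentDeriv, neg_add_cancel, zero_smul]

theorem resK_d₂ (f : K k) : resK (d₂ k f) = 0 := by
  change ((laurentDeriv _ f).coeff (-1)).coeff (-1) = 0
  rw [FormalSum.coeff_laurentDeriv, neg_add_cancel, zero_smul, HahnSeries.coeff_zero]

theorem resQ_mul_comm (f g : Q k) : resQ (f * g) = resQ (g * f) :=
  PseudoDiff.trace_mul_comm (fun a b => by rw [mul_comm]) resK_d₁ f g

theorem res_mul_comm (L M : P k) : res (L * M) = res (M * L) :=
  PseudoDiff.trace_mul_comm (τ := resQ) resQ_mul_comm (fun a => resK_d₂ (a.coeff (-1))) L M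

theorem resK_nondegenerate (b : K k) (h : ∀ a, resK (a * b) = 0) : b = 0 := by
  by_contra hb
  have := h (HahnSeries.single (-1) (HahnSeries.single (-1) 1) * b⁻¹)
  simp [resK, mul_assoc, inv_mul_cancel₀ hb] at this

theorem res_nondegenerate (U : P k) (h : ∀ M, res (M * U) = 0) : U = 0 :=
  PseudoDiff.eq_zero_of_trace_mul_eq_zero (τ := resQ)
    (fun V => PseudoDiff.eq_zero_of_trace_mul_eq_zero resK_nondegenerate V) U h

theorem orderLE_minus (L : P k) : (minus L).OrderLE (-1) := fun i hi => by
  change L.coeff i - (if 0 ≤ i then L.coeff i else 0) = 0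
  rw [if_pos (by omega), sub_self]

theorem res_minus_mul_minus (L M : P k) : res (minus L * minus M) = 0 := by
  change resQ ((minus L * minus M).coeff (-1)) = 0
  rw [(orderLE_minus L).mul (orderLE_minus M) (-1) (by norm_num), map_zero]

theorem res_plus_mul_plus (L M : P k) : res (plus L * plus M) = 0 := by
  have coeff_plus (L : P k) : ∀ i < 0, (plus L).coeff i = 0 := fun i hi => if_neg (not_le.2 hi)
  change resQ ((plus L * plus M).coeff (-1)) = 0
  rw [PseudoDiff.coeff_mul_of_forall_neg (coeff_plus L) (coeff_plus M) (by norm_num), map_zero]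

end Operators

section Support

/-- The set `E` is a support for the iterated Laurent series whose exponents are the functions `φ`,
from the outermost variable to the innermost: once the exponents before `r` are fixed, the exponent
`φ r` is bounded below on `E`. -/
def IsSupport {ι X : Type*} [LT ι] (φ : ι → X → ℤ) (E : Set X) : Prop :=
  ∀ r x, ∃ N, ∀ e ∈ E, (∀ s < r, φ s e = φ s x) → N ≤ φ r e

-- An infinite set on which the exponents before `r` are fixed and `φ r` is injective and
-- nonnegative is a support.
theorem exists_le_of_forall_isSupport_finite {ι X : Type*} [LinearOrder ι] {φ : ι → X → ℤ}
    {Z : Set X} (h : ∀ E ⊆ Z, IsSupport φ E → E.Finite) (r : ι) (x : X) :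
    ∃ N, ∀ e ∈ Z, (∀ s < r, φ s e = φ s x) → φ r e ≤ N := by
  obtain ⟨E, hEY, hbij⟩ :=
    (Set.surjOn_image (φ r) {e ∈ Z | (∀ s < r, φ s e = φ s x) ∧ 0 ≤ φ r e}).exists_bijOn_subset
  have hE : IsSupport φ E := fun s y => by
    rcases lt_trichotomy s r with hs | rfl | hs
    · exact ⟨φ s x, fun e he _ => ((hEY he).2.1 s hs).ge⟩
    · exact ⟨0, fun e he _ => (hEY he).2.2⟩
    · by_cases hne : ∃ e ∈ E, ∀ t < s, φ t e = φ t y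
      · obtain ⟨e, he, hey⟩ := hne
        refine ⟨φ s e, fun e' he' hey' => ?_⟩
        rw [hbij.injOn he he' ((hey r hs).trans (hey' r hs).symm)]
      · exact ⟨0, fun e he hey => (hne ⟨e, he, hey⟩).elim⟩
  have hfin := (h E (fun e he => (hEY he).1) hE).image (φ r)
  rw [hbij.image_eq] at hfin
  obtain ⟨N, hN⟩ := hfin.bddAbove
  refine ⟨max N 0, fun e he hex => ?_⟩
  rcases le_total 0 (φ r e) with h0 | h0
  · exact le_max_of_le_left (hN ⟨e, ⟨he, hex, h0⟩, rfl⟩)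
  · exact le_max_of_le_right h0

/-- The exponents of a monomial, from the outermost variable of `P` to the innermost, with the
signs for which they are bounded below on supports. -/
def expoCoord : Fin 4 → Expo → ℤ :=
  ![fun e => -e.j₂, fun e => -e.j₁, fun e => e.i₂, fun e => e.i₁]

theorem laurent_exists_coeff_eq {R : Type*} [Zero R] {u : ℤ → R} {N : ℤ} (hu : ∀ n < N, u n = 0) :
    ∃ f : LaurentSeries R, ∀ n, f.coeff n = u n :=
  ⟨HahnSeries.ofSuppBddBelow u ⟨N, fun n hn => not_lt.1 fun h => hn (hu n h)⟩, fun _ => rfl⟩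

theorem IsSupport.exists_entry_eq {k : Type*} [Field k] {u : Expo → k}
    (h : IsSupport expoCoord (Function.support u)) : ∃ M : P k, ∀ e, P.entry M e = u e := by
  have eq_zero (r : Fin 4) (x : Expo) : ∃ N, ∀ e, (∀ s < r, expoCoord s e = expoCoord s x) →
      expoCoord r e < N → u e = 0 := by
    obtain ⟨N, hN⟩ := h r x
    exact ⟨N, fun e he hlt => by_contra fun hu => (hN e hu he).not_gt hlt⟩
  have exists_laurent (b a c : ℤ) : ∃ f : LaurentSeries k, ∀ i, f.coeff i = u ⟨i, c, a, b⟩ := by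
    obtain ⟨N, hN⟩ := eq_zero 3 ⟨0, c, a, b⟩
    exact laurent_exists_coeff_eq fun i hi =>
      hN ⟨i, c, a, b⟩ (by simp [Fin.forall_fin_succ, expoCoord]) hi
  choose f hf using exists_laurent
  have exists_K (b a : ℤ) : ∃ g : K k, ∀ c, g.coeff c = f b a c := by
    obtain ⟨N, hN⟩ := eq_zero 2 ⟨0, 0, a, b⟩
    refine laurent_exists_coeff_eq (N := N) fun c hc => HahnSeries.ext (funext fun i => ?_)
    rw [hf]
    exact hN ⟨i, c, a, b⟩ (by simp [Fin.forall_fin_succ, expoCoord]) hc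
  choose g hg using exists_K
  have exists_Q (b : ℤ) : ∃ q : Q k, ∀ a, q.coeff a = g b a := by
    obtain ⟨N, hN⟩ := eq_zero 1 ⟨0, 0, 0, b⟩
    refine ⟨⟨g b, -N, fun a ha => ?_⟩, fun a => rfl⟩
    ext c i
    rw [hg, hf]
    exact hN ⟨i, c, a, b⟩ (by simp [expoCoord]) (neg_lt.1 ha)
  choose q hq using exists_Q
  obtain ⟨N, hN⟩ := eq_zero 0 ⟨0, 0, 0, 0⟩
  refine ⟨⟨q, -N, fun b hb => ?_⟩, fun e => ?_⟩
  · ext a c i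
    rw [hq, hg, hf]
    exact hN ⟨i, c, a, b⟩ (by simp) (neg_lt.1 hb)
  · change (((q e.j₂).coeff e.j₁).coeff e.i₂).coeff e.i₁ = _
    rw [hq, hg, hf]

/-- The exponent complementary to `e`: the product of the two monomials has the exponents of the
residue. -/
def Expo.dual (e : Expo) : Expo := ⟨-1 - e.i₁, -1 - e.i₂, -1 - e.j₁, -1 - e.j₂⟩

theorem Expo.dual_dual (e : Expo) : e.dual.dual = e := by
  simp [Expo.dual]

theorem isSupport_preimage_dual {Z : Set Expo} (h : ∀ E ⊆ Z, IsSupport expoCoord E → E.Finite) :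
    IsSupport expoCoord (Expo.dual ⁻¹' Z) := by
  have coord_dual (r : Fin 4) (e : Expo) :
      expoCoord r e.dual = ![1, 1, -1, -1] r - expoCoord r e := by
    fin_cases r <;> simp [expoCoord, Expo.dual] <;> ring
  intro r x
  obtain ⟨N, hN⟩ := exists_le_of_forall_isSupport_finite h r x.dual
  refine ⟨![1, 1, -1, -1] r - N, fun e he hex => ?_⟩
  have := hN e.dual he fun s hs => by rw [coord_dual, coord_dual, hex s hs]
  rw [coord_dual] at this
  omega

end Support

section Residue

variable {k : Type*} [Field k]

theorem exists_res_mono_mul_ofRight (M : P k) :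
    ∃ U : P k, ∀ e, res (P.mono k e * U) = P.entry M e.dual := by
  obtain ⟨N, hN⟩ := M.bdd
  let M' : P k := ⟨fun n => PseudoDiff.ofRight (M.coeff n), N, fun n hn => by
    rw [hN n hn, PseudoDiff.ofRight_zero]⟩
  refine ⟨PseudoDiff.ofRight M', fun e => ?_⟩
  calc res (P.mono k e * PseudoDiff.ofRight M')
      = resQ (PseudoDiff.single e.j₁ (HahnSeries.single e.i₂ (HahnSeries.single e.i₁ 1)) *
          PseudoDiff.ofRight (M.coeff (-1 - e.j₂))) :=
        congrArg resQ (PseudoDiff.coeff_neg_one_single_mul_ofRight M' _ _)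
    _ = resK (HahnSeries.single e.i₂ (HahnSeries.single e.i₁ 1) *
          (M.coeff (-1 - e.j₂)).coeff (-1 - e.j₁)) :=
        congrArg resK (PseudoDiff.coeff_neg_one_single_mul_ofRight _ _ _)
    _ = P.entry M e.dual := by
        change HahnSeries.coeff (HahnSeries.coeff _ _) _ = _
        rw [HahnSeries.coeff_single_mul, HahnSeries.coeff_single_mul, one_mul]
        rfl

theorem exists_res_mono_mul_eq {a : Expo → k}
    (h : ∀ M : P k, (Function.support fun e => a e * P.entry M e).Finite) :
    ∃ U : P k, ∀ e, res (P.mono k e * U) = a e := by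
  classical
  have hs : IsSupport expoCoord (Function.support fun e : Expo => a e.dual) := by
    refine isSupport_preimage_dual (Z := Function.support a) fun E hE hEs => ?_
    obtain ⟨M, hM⟩ := IsSupport.exists_entry_eq (u := E.indicator (1 : Expo → k))
      (by simpa [Set.support_indicator] using hEs)
    refine (h M).subset fun e he => ?_
    rw [Function.mem_support, hM, Set.indicator_of_mem he, Pi.one_apply, mul_one]
    exact hE he
  obtain ⟨M, hM⟩ := hs.exists_entry_eq
  obtain ⟨U, hU⟩ := exists_res_mono_mul_ofRight M
  exact ⟨U, fun e => by rw [hU, hM, Expo.dual_dual]⟩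

theorem hasSum_res_mono_mul (M U : P k) :
    (FormalSum.discrete k).HasSum (fun e => P.entry M e * res (P.mono k e * U)) (res (M * U)) := by
  have h := hasSum_entry ((sumP k).mul (hasSum_mono M) ((sumP k).unit U)) ⟨-1, -1, -1, -1⟩
  have entry_mul (p : Expo × Unit) : P.entry (P.entry M p.1 • P.mono k p.1 * U) ⟨-1, -1, -1, -1⟩ =
      P.entry M p.1 * res (P.mono k p.1 * U) := by
    rw [smul_mul_assoc]
    rfl
  simp only [entry_mul] at h
  exact ⟨(h.1.image Prod.fst).subset fun e he => ⟨(e, ()), he, rfl⟩,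
    h.2.trans (finsum_comp_equiv (Equiv.prodPUnit Expo)
      (f := fun e => P.entry M e * res (P.mono k e * U)))⟩

end Residue

section Monomials

variable {σ R R' : Type*} [CommRing R] [CommRing R']

/-- The value of a monomial at a point with coordinates in a ring. -/
def monoAt (μ : σ →₀ ℕ) (x : σ → R) : R := μ.prod fun v e => x v ^ e

/-- The derivative of a monomial at the point `x` in the direction `z`. -/
noncomputable def dmonoAt (μ : σ →₀ ℕ) (x z : σ → R) : R :=
  μ.sum fun v e => e * monoAt (μ - Finsupp.single v 1) x * z v

theorem monoAt_add (μ ν : σ →₀ ℕ) (x : σ → R) : monoAt (μ + ν) x = monoAt μ x * monoAt ν x :=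
  Finsupp.prod_add_index' (fun _ => pow_zero _) fun _ _ _ => pow_add _ _ _

theorem monoAt_single_one (v : σ) (x : σ → R) : monoAt (Finsupp.single v 1) x = x v :=
  (Finsupp.prod_single_index (h := fun v e => x v ^ e) (pow_zero _)).trans (pow_one _)

theorem monoAt_sub_single_mul {μ : σ →₀ ℕ} {v : σ} (hv : v ∈ μ.support) (x : σ → R) :
    monoAt (μ - Finsupp.single v 1) x * x v = monoAt μ x := by
  have hle : Finsupp.single v 1 ≤ μ :=
    Finsupp.single_le_iff.2 (Nat.one_le_iff_ne_zero.2 (Finsupp.mem_support_iff.1 hv))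
  conv_rhs => rw [← tsub_add_cancel_of_le hle, monoAt_add, monoAt_single_one]

theorem map_monoAt {F : Type*} [FunLike F R R'] [RingHomClass F R R'] (φ : F) (μ : σ →₀ ℕ)
    (x : σ → R) : φ (monoAt μ x) = monoAt μ fun v => φ (x v) := by
  simp only [monoAt, map_finsuppProd, map_pow]

theorem map_dmonoAt {F : Type*} [FunLike F R R'] [RingHomClass F R R'] (φ : F) (μ : σ →₀ ℕ)
    (x z : σ → R) : φ (dmonoAt μ x z) = dmonoAt μ (fun v => φ (x v)) fun v => φ (z v) := by
  simp only [dmonoAt, map_finsuppSum, map_mul, map_natCast, map_monoAt]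

theorem RingDeriv.map_monoAt (δ : RingDeriv R) (μ : σ →₀ ℕ) (x : σ → R) :
    δ (monoAt μ x) = dmonoAt μ x fun v => δ (x v) := by
  let _ : Algebra (MvPolynomial σ ℤ) R := (MvPolynomial.aeval x).toAlgebra
  have smul_def (p : MvPolynomial σ ℤ) (a : R) : p • a = MvPolynomial.aeval x p * a := rfl
  let D : Derivation ℤ R R := Derivation.mk' (AddMonoidHom.mk' δ (map_add δ)).toIntLinearMap
    fun a b => (δ.leibniz a b).trans ((add_comm _ _).trans (by simp [mul_comm]))
  have hD : D.compAlgebraMap (MvPolynomial σ ℤ) = MvPolynomial.mkDerivation ℤ fun v => δ (x v) :=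
    MvPolynomial.derivation_ext fun v => by
      rw [MvPolynomial.mkDerivation_X]
      exact congrArg δ (MvPolynomial.aeval_X x v)
  have h := DFunLike.congr_fun hD (MvPolynomial.monomial μ 1)
  rw [MvPolynomial.mkDerivation_monomial, one_smul] at h
  simp only [smul_def, MvPolynomial.aeval_monomial, map_natCast] at h
  refine Eq.trans (congrArg δ ?_) h
  exact ((MvPolynomial.aeval_monomial x μ 1).trans (by simp [monoAt])).symm

theorem totalDegree_monoAt_le {ι : Type*} {y : σ → MvPolynomial ι R}
    (hy : ∀ v, (y v).totalDegree ≤ 1) (μ : σ →₀ ℕ) : (monoAt μ y).totalDegree ≤ μ.degree :=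
  (MvPolynomial.totalDegree_finsetProd _ _).trans <| Finset.sum_le_sum fun v _ =>
    (MvPolynomial.totalDegree_pow _ _).trans <|
      (Nat.mul_le_mul_left _ (hy v)).trans (mul_one _).le

/-- The line through `x` in the direction `z`. -/
noncomputable def line {R : Type*} [Ring R] (x z : σ → R) (v : σ) : Polynomial R :=
  Polynomial.C (x v) + Polynomial.X * Polynomial.C (z v)

theorem eval_monoAt_line (ε : R) (μ : σ →₀ ℕ) (x z : σ → R) :
    (monoAt μ (line x z)).eval ε = monoAt μ (x + ε • z) := by
  rw [← Polynomial.coe_evalRingHom, map_monoAt]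
  congr 1
  funext v
  simp [line, mul_comm ε]

/-- The derivative of polynomials, over a ring that need not be commutative. -/
noncomputable def polyDeriv (R : Type*) [Ring R] : RingDeriv (Polynomial R) where
  toFun p := Polynomial.derivative p
  map_zero' := map_zero _
  map_add' := map_add _
  leibniz' _ _ := Polynomial.derivative_mul

theorem derivative_monoAt_line (μ : σ →₀ ℕ) (x z : σ → R) :
    (Polynomial.derivative (monoAt μ (line x z))).eval 0 = dmonoAt μ x z := by
  have h := (polyDeriv R).map_monoAt μ (line x z)
  change (polyDeriv R (monoAt μ (line x z))).eval 0 = _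
  rw [h, ← Polynomial.coe_evalRingHom, map_dmonoAt]
  congr 1 <;> funext v
  · simp [line]
  · change (Polynomial.derivative (line x z v)).eval 0 = _
    simp [line]

end Monomials

section Points

variable {k : Type*} [Field k]

/-- The index of a coefficient of a pair of operators. -/
abbrev Var : Type := Fin 2 × Expo

/-- The coefficients of a pair of operators. -/
noncomputable def coord : P2 k →ₗ[k] Var → k :=
  LinearMap.pi fun v => entryL v.2 ∘ₗ LinearMap.proj v.1

theorem coord_apply (L : P2 k) (v : Var) : coord L v = P.entry (L v.1) v.2 := rfl

theorem coord_injective : Function.Injective (coord : P2 k → Var → k) := fun _ _ h =>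
  funext fun i => P.entry_ext fun e => congrFun h (i, e)

/-- The coefficient families of the functionals: the degrees are bounded, and at each point only
finitely many terms are nonzero. -/
structure IsFunctionalCoeff (c : (Var →₀ ℕ) → k) : Prop where
  exists_degree_le : ∃ D, ∀ μ, c μ ≠ 0 → μ.degree ≤ D
  finite_support : ∀ L, (Function.support fun μ => c μ * monoAt μ (coord L)).Finite

/-- The functional with the coefficients `c`. -/
noncomputable def ofCoeff (c : (Var →₀ ℕ) → k) (L : P2 k) : k := ∑ᶠ μ, c μ * monoAt μ (coord L)

theorem mem_functionals_iff {F : P2 k → k} :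
    F ∈ Functionals k ↔ ∃ c, IsFunctionalCoeff c ∧ ofCoeff c = F :=
  ⟨fun ⟨c, D, hD, hc⟩ => ⟨c, ⟨⟨D, hD⟩, fun L => (hc L).1⟩, funext fun L => (hc L).2.symm⟩,
    fun ⟨c, ⟨⟨D, hD⟩, hc⟩, hF⟩ => ⟨c, D, hD, fun L => ⟨hc L, (congrFun hF L).symm⟩⟩⟩

variable {R R' : Type*} [CommRing R] [Algebra k R] [CommRing R'] [Algebra k R']

variable (k R) in
/-- The points of `P²` with coordinates in `R`: the linear combinations of pairs of operators with
coefficients in `R`. -/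
noncomputable def points : Submodule R (Var → R) :=
  Submodule.span R (Set.range fun (L : P2 k) v => algebraMap k R (coord L v))

theorem algebraMap_coord_mem_points (L : P2 k) :
    (fun v => algebraMap k R (coord L v)) ∈ points k R :=
  Submodule.subset_span ⟨L, rfl⟩

theorem coord_mem_points (L : P2 k) : coord L ∈ points k k :=
  algebraMap_coord_mem_points (R := k) L

theorem map_mem_points (φ : R →ₐ[k] R') {x : Var → R} (hx : x ∈ points k R) :
    (fun v => φ (x v)) ∈ points k R' := by
  induction hx using Submodule.span_induction with
  | mem x h =>
    obtain ⟨L, rfl⟩ := h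
    simpa using algebraMap_coord_mem_points L
  | zero =>
    simp only [Pi.zero_apply, map_zero]
    exact (points k R').zero_mem
  | add x y _ _ hx hy =>
    simp only [Pi.add_apply, map_add]
    exact (points k R').add_mem hx hy
  | smul c x _ hx =>
    simp only [Pi.smul_apply, smul_eq_mul, map_mul]
    exact (points k R').smul_mem (φ c) hx

theorem line_mem_points {x z : Var → R} (hx : x ∈ points k R) (hz : z ∈ points k R) :
    line x z ∈ points k (Polynomial R) :=
  (points k (Polynomial R)).add_mem (map_mem_points Polynomial.CAlgHom hx)
    ((points k (Polynomial R)).smul_mem Polynomial.X (map_mem_points Polynomial.CAlgHom hz))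

/-- The linear combination of the operators `L i` with indeterminate coefficients, as a point of
`P²` with coordinates in a polynomial ring. -/
noncomputable def genericPoint {ι : Type*} [Fintype ι] (L : ι → P2 k) (v : Var) :
    MvPolynomial ι k :=
  ∑ i, MvPolynomial.C (coord (L i) v) * MvPolynomial.X i

theorem totalDegree_genericPoint_le {ι : Type*} [Fintype ι] (L : ι → P2 k) (v : Var) :
    (genericPoint L v).totalDegree ≤ 1 :=
  MvPolynomial.totalDegree_finsetSum_le fun _ _ =>
    (MvPolynomial.totalDegree_mul _ _).trans (by simp)

theorem eval_monoAt_genericPoint {ι : Type*} [Fintype ι] (L : ι → P2 k) (t : ι → k)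
    (μ : Var →₀ ℕ) :
    MvPolynomial.eval t (monoAt μ (genericPoint L)) = monoAt μ (coord (∑ i, t i • L i)) := by
  rw [map_monoAt]
  congr 1
  funext v
  simp [genericPoint, mul_comm]

theorem exists_aeval_genericPoint_eq {x : Var → R} (hx : x ∈ points k R) :
    ∃ (s : Finset (P2 k)) (r : s → R), ∀ v,
      MvPolynomial.aeval r (genericPoint (Subtype.val : s → P2 k) v) = x v := by
  obtain ⟨r, rfl⟩ := Finsupp.mem_span_range_iff_exists_finsupp.1 hx
  refine ⟨r.support, fun L => r L, fun v => ?_⟩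
  simp only [genericPoint, map_sum, map_mul, MvPolynomial.aeval_X, MvPolynomial.algHom_C,
    Finsupp.sum, Finset.sum_apply, Pi.smul_apply, smul_eq_mul]
  rw [← Finset.sum_coe_sort r.support]
  exact Finset.sum_congr rfl fun i _ => mul_comm _ _

-- A nonzero value comes from a nonzero value at the generic point. There the monomials have bounded
-- degree, so each is nonzero at some point of a fixed finite grid.
theorem IsFunctionalCoeff.finite_monoAt_ne_zero [CharZero k] {c : (Var →₀ ℕ) → k}
    (hc : IsFunctionalCoeff c) {x : Var → R} (hx : x ∈ points k R) :
    {μ | c μ ≠ 0 ∧ monoAt μ x ≠ 0}.Finite := by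
  classical
  obtain ⟨D, hD⟩ := hc.exists_degree_le
  obtain ⟨s, r, hr⟩ := exists_aeval_genericPoint_eq hx
  let y := genericPoint (Subtype.val : s → P2 k)
  let G : Finset k := (Finset.range (D + 1)).image Nat.cast
  have card_G : G.card = D + 1 := by
    rw [Finset.card_image_of_injective _ Nat.cast_injective, Finset.card_range]
  refine ((Fintype.piFinset fun _ : s => G).finite_toSet.biUnion fun t _ =>
    hc.finite_support (∑ i : s, t i • (i : P2 k))).subset ?_
  rintro μ ⟨hμ, hμx⟩
  have hμy : monoAt μ y ≠ 0 := fun h => hμx <| by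
    rw [← funext hr, ← map_monoAt, h, map_zero]
  obtain ⟨t, ht, hty⟩ : ∃ t : s → k, (∀ i, t i ∈ G) ∧ MvPolynomial.eval t (monoAt μ y) ≠ 0 := by
    by_contra! h
    refine hμy (MvPolynomial.eq_zero_of_eval_zero_at_prod_finset _ (fun _ => G) (fun i => ?_) h)
    rw [card_G, Nat.lt_succ_iff]
    exact (MvPolynomial.degreeOf_le_totalDegree _ _).trans
      ((totalDegree_monoAt_le (totalDegree_genericPoint_le _) μ).trans (hD μ hμ))
  rw [eval_monoAt_genericPoint] at hty
  exact Set.mem_biUnion (x := t) (by simpa using ht) (mul_ne_zero hμ hty)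

theorem IsFunctionalCoeff.finite_dmonoAt_ne_zero [CharZero k] {c : (Var →₀ ℕ) → k}
    (hc : IsFunctionalCoeff c) {x z : Var → R} (hx : x ∈ points k R) (hz : z ∈ points k R) :
    {μ | c μ ≠ 0 ∧ dmonoAt μ x z ≠ 0}.Finite := by
  refine (hc.finite_monoAt_ne_zero (line_mem_points hx hz)).subset fun μ ⟨hμ, hd⟩ => ⟨hμ, ?_⟩
  intro h
  rw [← derivative_monoAt_line, h, Polynomial.derivative_zero, Polynomial.eval_zero] at hd
  exact hd rfl

theorem exists_forall_finsum_mul_eq {ι V : Type*} [AddCommGroup V] [Module k V] {c : ι → k}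
    {u : ι → V} (h : {i | c i ≠ 0 ∧ u i ≠ 0}.Finite) :
    ∃ p : V, ∀ φ : V →ₗ[k] k, ∑ᶠ i, c i * φ (u i) = φ p := by
  refine ⟨∑ᶠ i, c i • u i, fun φ => ?_⟩
  have hfin : (Function.support fun i => c i • u i).Finite :=
    h.subset fun i hi => smul_ne_zero_iff.1 hi
  exact (finsum_congr fun i => (map_smul φ (c i) (u i)).symm).trans
    (AddMonoidHom.map_finsum φ.toAddMonoidHom hfin).symm

theorem IsFunctionalCoeff.hasDirDeriv [CharZero k] {c : (Var →₀ ℕ) → k} (hc : IsFunctionalCoeff c)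
    (L M : P2 k) :
    HasDirDeriv (ofCoeff c) L M (∑ᶠ μ, c μ * dmonoAt μ (coord L) (coord M)) := by
  obtain ⟨p, hp⟩ := exists_forall_finsum_mul_eq <| hc.finite_monoAt_ne_zero <|
    line_mem_points (coord_mem_points L) (coord_mem_points M)
  refine ⟨p, fun ε => ?_, ?_⟩
  · refine Eq.trans (finsum_congr fun μ => ?_) (hp (Polynomial.leval ε))
    rw [Polynomial.leval_apply, eval_monoAt_line, map_add, map_smul]
  · refine (hp (Polynomial.leval 0 ∘ₗ Polynomial.derivative)).symm.trans (finsum_congr fun μ => ?_)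
    rw [LinearMap.comp_apply, Polynomial.leval_apply, derivative_monoAt_line]

end Points

section Gradient

variable {k : Type*} [Field k]

theorem HasDirDeriv.unique [CharZero k] {F : P2 k → k} {L M : P2 k} {v w : k}
    (hv : HasDirDeriv F L M v) (hw : HasDirDeriv F L M w) : v = w := by
  obtain ⟨p, hp, rfl⟩ := hv
  obtain ⟨q, hq, rfl⟩ := hw
  rw [Polynomial.funext fun ε => (hp ε).symm.trans (hq ε)]

theorem pair_single (i : Fin 2) (M : P k) (W : P2 k) : pair (Pi.single i M) W = res (M * W i) := by
  rw [pair, Finset.sum_eq_single i _ (by simp), Pi.single_eq_same]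
  intro j _ hj
  rw [Pi.single_eq_of_ne hj, zero_mul]
  exact map_zero (resL (k := k))

theorem IsGradient.unique [CharZero k] {F : P2 k → k} {L U V : P2 k} (hU : IsGradient F L U)
    (hV : IsGradient F L V) : U = V := by
  funext i
  refine sub_eq_zero.1 (res_nondegenerate _ fun M => ?_)
  have h := (hU (Pi.single i M)).unique (hV (Pi.single i M))
  rw [pair_single, pair_single] at h
  rw [mul_sub, res_sub, h, sub_self]

theorem finsum_finsum_comm {α β M : Type*} [AddCommMonoid M] {f : α → β → M}
    (h : (Function.support fun p : α × β => f p.1 p.2).Finite) :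
    ∑ᶠ a, ∑ᶠ b, f a b = ∑ᶠ b, ∑ᶠ a, f a b := by
  rw [← finsum_curry (fun p : α × β => f p.1 p.2) h, ← finsum_comp_equiv (Equiv.prodComm β α)]
  exact finsum_curry (fun p : β × α => f p.2 p.1)
    (h.preimage (Equiv.prodComm β α).injective.injOn)

/-- The term with index `μ` of the partial derivative of the functional `ofCoeff c` at `L` with
respect to the coefficient `v`. -/
noncomputable def partialTerm (c : (Var →₀ ℕ) → k) (L : P2 k) (μ : Var →₀ ℕ) (v : Var) : k :=
  c μ * (μ v * monoAt (μ - Finsupp.single v 1) (coord L))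

theorem mem_support_of_partialTerm_ne_zero {c : (Var →₀ ℕ) → k} {L : P2 k} {μ : Var →₀ ℕ} {v : Var}
    (h : partialTerm c L μ v ≠ 0) : v ∈ μ.support :=
  Finsupp.mem_support_iff.2 fun hv => h (by simp [partialTerm, hv])

theorem mul_dmonoAt_eq_finsum (c : (Var →₀ ℕ) → k) (L M : P2 k) (μ : Var →₀ ℕ) :
    c μ * dmonoAt μ (coord L) (coord M) = ∑ᶠ v, partialTerm c L μ v * coord M v := by
  rw [finsum_eq_sum_of_support_subset (s := μ.support), dmonoAt, Finsupp.sum, Finset.mul_sum]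
  · exact Finset.sum_congr rfl fun v _ => by simp only [partialTerm, mul_assoc]
  · exact fun v hv => mem_support_of_partialTerm_ne_zero (left_ne_zero_of_mul hv)

theorem IsFunctionalCoeff.finite_partialTerm_mul [CharZero k] {c : (Var →₀ ℕ) → k}
    (hc : IsFunctionalCoeff c) (L M : P2 k) :
    (Function.support fun p : (Var →₀ ℕ) × Var =>
      partialTerm c L p.1 p.2 * coord M p.2).Finite := by
  have hfin := hc.finite_monoAt_ne_zero <|
    line_mem_points (coord_mem_points L) (coord_mem_points M)
  refine (hfin.biUnion fun μ _ => ((Set.finite_singleton μ).prod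
    (Finset.finite_toSet μ.support))).subset ?_
  rintro ⟨μ, v⟩ h
  have hterm := left_ne_zero_of_mul h
  have hv := mem_support_of_partialTerm_ne_zero hterm
  refine Set.mem_biUnion (x := μ) ⟨left_ne_zero_of_mul hterm, ?_⟩ ⟨rfl, hv⟩
  rw [← monoAt_sub_single_mul hv]
  refine mul_ne_zero (fun h0 => ?_) fun h0 => right_ne_zero_of_mul h ?_
  · have := congrArg (Polynomial.eval 0) h0
    rw [eval_monoAt_line, zero_smul, add_zero, Polynomial.eval_zero] at this
    exact right_ne_zero_of_mul (right_ne_zero_of_mul hterm) this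
  · simpa [line] using congrArg (Polynomial.coeff · 1) h0

theorem finsum_mul_dmonoAt_eq [CharZero k] {c : (Var →₀ ℕ) → k} (hc : IsFunctionalCoeff c)
    (L M : P2 k) : ∑ᶠ μ, c μ * dmonoAt μ (coord L) (coord M) =
      ∑ᶠ v, (∑ᶠ μ, partialTerm c L μ v) * coord M v := by
  simp only [mul_dmonoAt_eq_finsum, finsum_mul]
  exact finsum_finsum_comm (hc.finite_partialTerm_mul L M)

theorem finite_finsum_partialTerm_mul [CharZero k] {c : (Var →₀ ℕ) → k}
    (hc : IsFunctionalCoeff c) (L M : P2 k) :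
    (Function.support fun v => (∑ᶠ μ, partialTerm c L μ v) * coord M v).Finite := by
  refine ((hc.finite_partialTerm_mul L M).image Prod.snd).subset fun v hv => ?_
  rw [Function.mem_support, finsum_mul] at hv
  obtain ⟨μ, hμ⟩ := not_forall.1 fun h => hv (finsum_eq_zero_of_forall_eq_zero h)
  exact ⟨(μ, v), hμ, rfl⟩

theorem exists_isGradient [CharZero k] {F : P2 k → k} (hF : F ∈ Functionals k) (L : P2 k) :
    ∃ U, IsGradient F L U := by
  obtain ⟨c, hc, rfl⟩ := mem_functionals_iff.1 hF
  have exists_entry (i : Fin 2) :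
      ∃ U : P k, ∀ e, res (P.mono k e * U) = ∑ᶠ μ, partialTerm c L μ (i, e) :=
    exists_res_mono_mul_eq fun M =>
      ((finite_finsum_partialTerm_mul hc L (Pi.single i M)).preimage
        (Prod.mk_right_injective i).injOn).subset fun e he => by
          simpa only [Set.mem_preimage, Function.mem_support, coord_apply,
            Pi.single_eq_same] using he
  choose U hU using exists_entry
  have key (M : P2 k) : ∑ᶠ μ, c μ * dmonoAt μ (coord L) (coord M) = pair M U := by
    rw [finsum_mul_dmonoAt_eq hc, finsum_curry _ (finite_finsum_partialTerm_mul hc L M),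
      finsum_eq_sum_of_fintype]
    refine Finset.sum_congr rfl fun i _ => ?_
    rw [(hasSum_res_mono_mul (M i) (U i)).2]
    exact finsum_congr fun e => (mul_comm _ _).trans (congrArg (P.entry (M i) e * ·) (hU i e).symm)
  exact ⟨U, fun M => key M ▸ hc.hasDirDeriv L M⟩

theorem existsUnique_isGradient [CharZero k] {F : P2 k → k} (hF : F ∈ Functionals k) (L : P2 k) :
    ∃! U, IsGradient F L U :=
  existsUnique_of_exists_of_unique (exists_isGradient hF L) fun _ _ => IsGradient.unique

theorem isGradient_grad [CharZero k] {F : P2 k → k} (hF : F ∈ Functionals k) (L : P2 k) :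
    IsGradient F L (grad F L) :=
  Classical.epsilon_spec (exists_isGradient hF L)

theorem IsGradient.grad_eq [CharZero k] {F : P2 k → k} {L U : P2 k} (h : IsGradient F L U) :
    grad F L = U :=
  (Classical.epsilon_spec (p := IsGradient F L) ⟨U, h⟩).unique h

end Gradient

section CyclicDerivative

variable {A : Type*} [Ring A]

/-- The derivative of `y ^ n` in the direction `z`, over a ring that need not be commutative. -/
def powDeriv (y z : A) (n : ℕ) : A := ∑ s ∈ Finset.range n, y ^ s * z * y ^ (n - 1 - s)

theorem map_powDeriv {B : Type*} [Ring B] (φ : A →+* B) (y z : A) (n : ℕ) :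
    φ (powDeriv y z n) = powDeriv (φ y) (φ z) n := by
  simp only [powDeriv, map_sum, map_mul, map_pow]

theorem powDeriv_of_commute {y z : A} (h : Commute y z) (n : ℕ) :
    powDeriv y z n = n • (y ^ (n - 1) * z) := by
  rw [powDeriv, Finset.sum_eq_card_nsmul (b := y ^ (n - 1) * z), Finset.card_range]
  intro s hs
  rw [mul_assoc, ← (h.pow_left _).eq, ← mul_assoc, ← pow_add]
  congr 2
  have := Finset.mem_range.1 hs
  omega

theorem RingDeriv.pow (δ : RingDeriv A) (a : A) (n : ℕ) : δ (a ^ n) = powDeriv a (δ a) n := by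
  induction n with
  | zero => simpa [powDeriv] using δ.map_one'
  | succ n ih =>
    rw [pow_succ, RingDeriv.leibniz, ih, powDeriv, powDeriv, Finset.sum_range_succ, Finset.sum_mul]
    congr 1
    · refine Finset.sum_congr rfl fun s hs => ?_
      rw [mul_assoc, ← pow_succ]
      congr 2
      have := Finset.mem_range.1 hs
      omega
    · simp

theorem trace_powDeriv_mul {B : Type*} [AddCommGroup B] {τ : A →+ B}
    (hτ : ∀ a b, τ (a * b) = τ (b * a)) (y z w : A) (n : ℕ) :
    τ (powDeriv y z n * w) = τ (z * powDeriv y w n) := by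
  simp only [powDeriv, Finset.sum_mul, Finset.mul_sum, map_sum]
  rw [← Finset.sum_range_reflect]
  refine Finset.sum_congr rfl fun s hs => ?_
  rw [Nat.sub_sub_self (Nat.le_sub_one_of_lt (Finset.mem_range.1 hs)), mul_assoc, mul_assoc, hτ]
  simp only [mul_assoc]

/-- The noncommutative polynomial `∑ binom(m, a) x₀ᵃ x₁ᵇ`. -/
def binomSum (m : ℕ) (x : Fin 2 → A) : A :=
  ∑ p ∈ Finset.HasAntidiagonal.antidiagonal m, m.choose p.1 • (x 0 ^ p.1 * x 1 ^ p.2)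

/-- The cyclic derivative of `binomSum` with respect to `xᵢ`. The other variable is `x i.rev`. -/
def binomGrad (m : ℕ) (x : Fin 2 → A) (i : Fin 2) : A :=
  ∑ p ∈ Finset.HasAntidiagonal.antidiagonal m, m.choose p.1 • powDeriv (x i) (x i.rev ^ p.2) p.1

theorem map_binomSum {B : Type*} [Ring B] (φ : A →+* B) (m : ℕ) (x : Fin 2 → A) :
    φ (binomSum m x) = binomSum m fun i => φ (x i) := by
  simp only [binomSum, map_sum, map_nsmul, map_mul, map_pow]

theorem map_binomGrad {B : Type*} [Ring B] (φ : A →+* B) (m : ℕ) (x : Fin 2 → A) (i : Fin 2) :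
    φ (binomGrad m x i) = binomGrad m (fun i => φ (x i)) i := by
  simp only [binomGrad, map_sum, map_nsmul, map_powDeriv, map_pow]

theorem sum_choose_smul_powDeriv_of_commute {y z : A} (h : Commute y z) (m : ℕ) :
    ∑ p ∈ Finset.HasAntidiagonal.antidiagonal m, m.choose p.1 • powDeriv y (z ^ p.2) p.1 =
      m • (y + z) ^ (m - 1) := by
  simp only [powDeriv_of_commute (h.pow_right _), smul_smul]
  rcases m with _ | n
  · simp
  · rw [Nat.add_sub_cancel, h.add_pow', Finset.smul_sum, Finset.Nat.antidiagonal_succ,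
      Finset.sum_cons, Finset.sum_map, mul_zero, zero_smul, zero_add]
    refine Finset.sum_congr rfl fun p _ => ?_
    rw [smul_smul, Nat.add_one_mul_choose_eq]
    rfl

theorem binomGrad_of_commute {x : Fin 2 → A} (h : Commute (x 0) (x 1)) (m : ℕ) (i : Fin 2) :
    binomGrad m x i = m • (x 0 + x 1) ^ (m - 1) := by
  have hi : Commute (x i) (x i.rev) ∧ x i + x i.rev = x 0 + x 1 := by
    fin_cases i
    · exact ⟨h, rfl⟩
    · exact ⟨h.symm, add_comm _ _⟩
  rw [binomGrad, sum_choose_smul_powDeriv_of_commute hi.1, hi.2]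

theorem RingDeriv.binomSum (δ : RingDeriv A) (m : ℕ) (x : Fin 2 → A) :
    δ (binomSum m x) = ∑ p ∈ Finset.HasAntidiagonal.antidiagonal m, m.choose p.1 •
      (powDeriv (x 0) (δ (x 0)) p.1 * x 1 ^ p.2 + x 0 ^ p.1 * powDeriv (x 1) (δ (x 1)) p.2) := by
  simp only [PDO.binomSum, map_sum, map_nsmul, RingDeriv.leibniz, RingDeriv.pow]

theorem trace_deriv_binomSum {B : Type*} [AddCommGroup B] {τ : A →+ B}
    (hτ : ∀ a b, τ (a * b) = τ (b * a)) (δ : RingDeriv A) (m : ℕ) (x : Fin 2 → A) :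
    τ (δ (binomSum m x)) = ∑ i, τ (δ (x i) * binomGrad m x i) := by
  have h1 : binomGrad m x 1 = ∑ p ∈ Finset.HasAntidiagonal.antidiagonal m,
      m.choose p.1 • powDeriv (x 1) (x 0 ^ p.1) p.2 := by
    rw [binomGrad, ← Finset.Nat.sum_antidiagonal_swap]
    refine Finset.sum_congr rfl fun p hp => ?_
    rw [Nat.choose_symm_of_eq_add (Finset.HasAntidiagonal.mem_antidiagonal.1 hp).symm]
    rfl
  rw [δ.binomSum, Fin.sum_univ_two, h1, binomGrad]
  simp only [Finset.mul_sum, mul_smul_comm, map_sum, map_nsmul]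
  rw [← Finset.sum_add_distrib]
  refine Finset.sum_congr rfl fun p _ => ?_
  rw [map_add, smul_add, trace_powDeriv_mul hτ, hτ (x 0 ^ p.1), trace_powDeriv_mul hτ]
  rfl

theorem RingDeriv.lie (δ : RingDeriv A) (a b : A) : δ ⁅a, b⁆ = ⁅δ a, b⁆ + ⁅a, δ b⁆ := by
  simp only [Ring.lie_def, map_sub, RingDeriv.leibniz]
  abel

/-- The inner derivation `[a, ·]`. -/
def innerDeriv (a : A) : RingDeriv A where
  toFun b := ⁅a, b⁆
  map_zero' := by simp only [Ring.lie_def, mul_zero, zero_mul, sub_zero]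
  map_add' b c := by
    simp only [Ring.lie_def]
    noncomm_ring
  leibniz' b c := by
    simp only [Ring.lie_def]
    noncomm_ring

end CyclicDerivative

section VectorField

variable (k : Type*) [Field k] {A : Type*} [Ring A] [Algebra k A]

/-- The gradient of `H_m`, as a noncommutative polynomial. -/
def gradH (m : ℕ) (x : Fin 2 → A) (i : Fin 2) : A := (1 / (m : k)) • binomGrad m x i

/-- The Hamiltonian vector field of `H_m`, for a splitting of the ring given by the projection
`π`: the bracket `[·, ·]_R` with the gradient, moved to the other side of the trace pairing. -/
def vecField (π : A →+ A) (m : ℕ) (x : Fin 2 → A) (i : Fin 2) : A :=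
  (⁅π (gradH k m x i), x i⁆ - π ⁅π (gradH k m x i), x i⁆) -
    π ⁅gradH k m x i - π (gradH k m x i), x i⁆

variable {k}

theorem map_vecField {B : Type*} [Ring B] [Algebra k B] (φ : A →+* B)
    (hφ : ∀ (c : k) a, φ (c • a) = c • φ a) {π : A →+ A} {π' : B →+ B}
    (hπ : ∀ a, φ (π a) = π' (φ a)) (m : ℕ) (x : Fin 2 → A) (i : Fin 2) :
    φ (vecField k π m x i) = vecField k π' m (fun i => φ (x i)) i := by
  simp only [vecField, gradH, map_sub, Ring.lie_def, map_mul, hπ, hφ, map_binomGrad]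

theorem gradH_of_commute [CharZero k] {m : ℕ} (hm : m ≠ 0) {x : Fin 2 → A}
    (h : Commute (x 0) (x 1)) (i : Fin 2) : gradH k m x i = (x 0 + x 1) ^ (m - 1) := by
  rw [gradH, binomGrad_of_commute h, ← Nat.cast_smul_eq_nsmul k, smul_smul,
    one_div_mul_cancel (Nat.cast_ne_zero.2 hm), one_smul]

theorem commute_add_pow {x : Fin 2 → A} (h : Commute (x 0) (x 1)) (n : ℕ) (i : Fin 2) :
    Commute ((x 0 + x 1) ^ n) (x i) := by
  refine Commute.pow_left ?_ n
  fin_cases i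
  · exact (Commute.refl _).add_left h.symm
  · exact h.add_left (Commute.refl _)

-- The gradient commutes with `x i`, so its two components have opposite commutators with `x i`.
theorem vecField_of_commute [CharZero k] (π : A →+ A) {m : ℕ} (hm : m ≠ 0) {x : Fin 2 → A}
    (h : Commute (x 0) (x 1)) (i : Fin 2) :
    vecField k π m x i = ⁅π ((x 0 + x 1) ^ (m - 1)), x i⁆ := by
  have lie_minus : ⁅(x 0 + x 1) ^ (m - 1) - π ((x 0 + x 1) ^ (m - 1)), x i⁆ =
      -⁅π ((x 0 + x 1) ^ (m - 1)), x i⁆ := by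
    simp only [Ring.lie_def, sub_mul, mul_sub, (commute_add_pow h (m - 1) i).eq]
    abel
  rw [vecField, gradH_of_commute hm h, lie_minus, map_neg, sub_neg_eq_add, sub_add_cancel]

end VectorField

section GradientOfHamiltonian

variable {k : Type*} [Field k] {A : Type*} [Ring A] [Algebra k A]

/-- The evaluation of polynomials over a `k`-algebra at scalars. -/
noncomputable def evalScalar (A : Type*) [Ring A] [Algebra k A] (ε : k) : Polynomial A →+* A :=
  Polynomial.eval₂RingHom' (RingHom.id A) (algebraMap k A ε) fun a => (Algebra.commutes ε a).symm

theorem evalScalar_line {σ : Type*} (x z : σ → A) (ε : k) (v : σ) :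
    evalScalar A ε (line x z v) = (x + ε • z) v := by
  rw [line, Polynomial.X_mul_C]
  change Polynomial.eval₂ _ _ _ = _
  rw [Polynomial.eval₂_add, Polynomial.eval₂_C, Polynomial.eval₂_mul_X, Polynomial.eval₂_C,
    ← Algebra.commutes, ← Algebra.smul_def]
  rfl

theorem exists_eval_eq_map_evalScalar (φ : A →ₗ[k] k) (f : Polynomial A) :
    ∃ p : Polynomial k, (∀ ε, φ (evalScalar A ε f) = p.eval ε) ∧ p.coeff 1 = φ (f.coeff 1) := by
  refine ⟨∑ n ∈ Finset.range (f.natDegree + 1), Polynomial.monomial n (φ (f.coeff n)),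
    fun ε => ?_, ?_⟩
  · change φ (Polynomial.eval₂ _ _ _) = _
    rw [Polynomial.eval₂_eq_sum_range, map_sum, Polynomial.eval_finsetSum]
    refine Finset.sum_congr rfl fun n _ => ?_
    rw [← map_pow, ← Algebra.commutes, ← Algebra.smul_def, map_smul, Polynomial.eval_monomial,
      smul_eq_mul, mul_comm]
    rfl
  · simp only [Polynomial.finsetSum_coeff, Polynomial.coeff_monomial, Finset.sum_ite_eq',
      Finset.mem_range]
    split_ifs with h
    · rfl
    · rw [Polynomial.coeff_eq_zero_of_natDegree_lt (by omega), map_zero]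

theorem exists_eval_eq_trace_binomSum {φ : A →ₗ[k] k} (hφ : ∀ a b, φ (a * b) = φ (b * a)) (m : ℕ)
    (x z : Fin 2 → A) : ∃ p : Polynomial k, (∀ ε : k, φ (binomSum m (x + ε • z)) = p.eval ε) ∧
      p.derivative.eval 0 = ∑ i, φ (z i * binomGrad m x i) := by
  obtain ⟨p, hp, hp1⟩ := exists_eval_eq_map_evalScalar φ (binomSum m (line x z))
  refine ⟨p, fun ε => ?_, ?_⟩
  · rw [← hp, map_binomSum]
    exact congrArg (fun y => φ (binomSum m y)) (funext fun i => (evalScalar_line x z ε i).symm)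
  · let τ : Polynomial A →+ k := φ.toAddMonoidHom.comp (Polynomial.lcoeff A 0).toAddMonoidHom
    have hτ (a b : Polynomial A) : τ (a * b) = τ (b * a) := by
      change φ ((a * b).coeff 0) = φ ((b * a).coeff 0)
      rw [Polynomial.mul_coeff_zero, Polynomial.mul_coeff_zero, hφ]
    have coeff_zero_grad (i) : (binomGrad m (line x z) i).coeff 0 = binomGrad m x i := by
      rw [← Polynomial.constantCoeff_apply, map_binomGrad]
      simp [line]
    have coeff_zero_deriv (i) : (Polynomial.derivative (line x z i)).coeff 0 = z i := by
      simp [line]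
    calc p.derivative.eval 0 = φ ((Polynomial.derivative (binomSum m (line x z))).coeff 0) := by
          simp [← Polynomial.coeff_zero_eq_eval_zero, Polynomial.coeff_derivative, hp1]
      _ = ∑ i, φ ((Polynomial.derivative (line x z i) * binomGrad m (line x z) i).coeff 0) :=
          trace_deriv_binomSum hτ (polyDeriv A) m (line x z)
      _ = ∑ i, φ (z i * binomGrad m x i) := by
          simp only [Polynomial.mul_coeff_zero, coeff_zero_grad, coeff_zero_deriv]

theorem H_eq {k : Type*} [Field k] (m : ℕ) (L : P2 k) :
    H m L = ((1 / (m : k)) • resL) (binomSum m L) := by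
  rw [LinearMap.smul_apply, binomSum, map_sum, H, smul_eq_mul]
  congr 1
  refine Finset.sum_congr rfl fun p _ => ?_
  rw [map_nsmul, nsmul_eq_mul]
  rfl

theorem isGradient_H {k : Type*} [Field k] (m : ℕ) (L : P2 k) :
    IsGradient (H m) L (gradH k m L) := by
  intro M
  obtain ⟨p, hp, hp'⟩ := exists_eval_eq_trace_binomSum (φ := (1 / (m : k)) • resL)
    (fun a b => congrArg ((1 / (m : k)) • ·) (res_mul_comm a b)) m L M
  refine ⟨p, fun ε => (H_eq m _).trans (hp ε), hp'.trans (Finset.sum_congr rfl fun i _ => ?_)⟩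
  rw [gradH, mul_smul_comm]
  exact (map_smul (resL (k := k)) _ _).symm

end GradientOfHamiltonian

section Functionals

variable {k : Type*} [Field k]

variable (k) in
/-- The functionals on `P²`, as a vector space. -/
noncomputable def functionalSubmodule : Submodule k (P2 k → k) where
  carrier := Functionals k
  zero_mem' := ⟨0, 0, fun μ h => absurd rfl h, fun L => by simp [Function.support]⟩
  add_mem' := by
    rintro F G ⟨c, D, hD, hc⟩ ⟨c', D', hD', hc'⟩
    refine ⟨c + c', max D D', fun μ hμ => ?_, fun L => ?_⟩
    · rcases (Function.support_add c c').trans subset_rfl hμ with h | h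
      · exact (hD μ h).trans (le_max_left _ _)
      · exact (hD' μ h).trans (le_max_right _ _)
    · simp only [Pi.add_apply, add_mul]
      exact ⟨((hc L).1.union (hc' L).1).subset (Function.support_add _ _),
        by rw [(hc L).2, (hc' L).2, finsum_add_distrib (hc L).1 (hc' L).1]⟩
  smul_mem' := by
    rintro a F ⟨c, D, hD, hc⟩
    refine ⟨a • c, D, fun μ hμ => hD μ (right_ne_zero_of_mul hμ), fun L => ?_⟩
    simp only [Pi.smul_apply, smul_eq_mul, mul_assoc]
    exact ⟨(hc L).1.subset fun μ hμ => right_ne_zero_of_mul hμ, by rw [(hc L).2, mul_finsum]⟩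

theorem finsum_finsum_ite_eq {I J M : Type*} [AddCommMonoid M] [DecidableEq J] {f : I → M}
    (hf : (Function.support f).Finite) (μ : I → J) :
    ∑ᶠ j, ∑ᶠ i, (if μ i = j then f i else 0) = ∑ᶠ i, f i := by
  have hfin : (Function.support fun p : J × I => if μ p.2 = p.1 then f p.2 else 0).Finite := by
    refine (hf.image fun i => (μ i, i)).subset fun p hp => ?_
    obtain ⟨hμ, hp⟩ := ite_ne_right_iff.1 hp
    exact ⟨p.2, hp, Prod.ext hμ rfl⟩
  rw [finsum_finsum_comm hfin]
  refine finsum_congr fun i => (finsum_eq_single _ (μ i) fun j hj => ?_).trans (if_pos rfl)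
  exact if_neg hj.symm

theorem mem_functionals_of_family {I : Type} {c : I → k} {μ : I → Var →₀ ℕ} {D : ℕ}
    (hμ : ∀ i, (μ i).degree ≤ D) {F : P2 k → k} (hF : ∀ L, (FormalSum.discrete k).HasSum
      (fun i => monoAt (μ i) (coord L) * c i) (F L)) : F ∈ Functionals k := by
  classical
  let c' : (Var →₀ ℕ) → k := fun ν => ∑ᶠ i, if μ i = ν then c i else 0
  have c'_mul (L : P2 k) (ν : Var →₀ ℕ) : c' ν * monoAt ν (coord L) =
      ∑ᶠ i, if μ i = ν then monoAt (μ i) (coord L) * c i else 0 := by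
    rw [finsum_mul]
    refine finsum_congr fun i => ?_
    split_ifs with h
    · rw [h, mul_comm]
    · exact zero_mul _
  refine mem_functionals_iff.2 ⟨c', ⟨⟨D, fun ν hν => ?_⟩, fun L => ?_⟩, funext fun L => ?_⟩
  · obtain ⟨i, hi⟩ := not_forall.1 (mt finsum_eq_zero_of_forall_eq_zero hν)
    exact (ite_ne_right_iff.1 hi).1 ▸ hμ i
  · refine ((hF L).1.image μ).subset fun ν hν => ?_
    rw [Function.mem_support, c'_mul] at hν
    obtain ⟨i, hi⟩ := not_forall.1 (mt finsum_eq_zero_of_forall_eq_zero hν)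
    obtain ⟨hμν, hi⟩ := ite_ne_right_iff.1 hi
    exact ⟨i, hi, hμν⟩
  · rw [(hF L).2, ← finsum_finsum_ite_eq (hF L).1 μ]
    exact finsum_congr (c'_mul L)

/-- The operator-valued functions that are formal sums of monomials of bounded degree with operator
coefficients. -/
def IsOperatorPolynomial (Φ : P2 k → P k) : Prop :=
  ∃ (I : Type) (μ : I → Var →₀ ℕ) (T : I → P k) (D : ℕ), (∀ i, (μ i).degree ≤ D) ∧
    ∀ L, (sumP k).HasSum (fun i => monoAt (μ i) (coord L) • T i) (Φ L)

theorem IsOperatorPolynomial.one : IsOperatorPolynomial fun _ : P2 k => 1 :=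
  ⟨Unit, fun _ => 0, fun _ => 1, 0, fun _ => by simp, fun L => by
    simpa [monoAt] using (sumP k).unit 1⟩

theorem IsOperatorPolynomial.proj (i : Fin 2) : IsOperatorPolynomial fun L : P2 k => L i :=
  ⟨Expo, fun e => Finsupp.single (i, e) 1, fun e => P.mono k e, 1, fun e => by simp, fun L => by
    simpa only [monoAt_single_one, coord_apply] using hasSum_mono (L i)⟩

theorem IsOperatorPolynomial.mul {Φ Ψ : P2 k → P k} (hΦ : IsOperatorPolynomial Φ)
    (hΨ : IsOperatorPolynomial Ψ) : IsOperatorPolynomial fun L => Φ L * Ψ L := by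
  obtain ⟨I, μ, T, D, hμ, hT⟩ := hΦ
  obtain ⟨J, ν, T', D', hν, hT'⟩ := hΨ
  refine ⟨I × J, fun p => μ p.1 + ν p.2, fun p => T p.1 * T' p.2, D + D', fun p => ?_, fun L => ?_⟩
  · rw [map_add]
    exact add_le_add (hμ _) (hν _)
  · simpa only [monoAt_add, smul_mul_smul_comm] using (sumP k).mul (hT L) (hT' L)

theorem IsOperatorPolynomial.pow {Φ : P2 k → P k} (h : IsOperatorPolynomial Φ) (n : ℕ) :
    IsOperatorPolynomial fun L => Φ L ^ n := by
  induction n with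
  | zero => simpa only [pow_zero] using IsOperatorPolynomial.one
  | succ n ih => simpa only [pow_succ] using ih.mul h

theorem IsOperatorPolynomial.entry_mem_functionals {Φ : P2 k → P k} (h : IsOperatorPolynomial Φ)
    (e : Expo) : (fun L => P.entry (Φ L) e) ∈ Functionals k := by
  obtain ⟨I, μ, T, D, hμ, hT⟩ := h
  exact mem_functionals_of_family (c := fun i => P.entry (T i) e) hμ fun L => hasSum_entry (hT L) e

theorem coord_mem_functionals (v : Var) : (fun L : P2 k => coord L v) ∈ Functionals k :=
  (IsOperatorPolynomial.proj v.1).entry_mem_functionals v.2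

theorem H_mem_functionals (m : ℕ) : (H m : P2 k → k) ∈ Functionals k := by
  have res_mem (a b : ℕ) : (fun L : P2 k => res (L 0 ^ a * L 1 ^ b)) ∈ functionalSubmodule k :=
    (((IsOperatorPolynomial.proj 0).pow a).mul
      ((IsOperatorPolynomial.proj 1).pow b)).entry_mem_functionals ⟨-1, -1, -1, -1⟩
  have h := (functionalSubmodule k).smul_mem (1 / (m : k)) <| (functionalSubmodule k).sum_mem
    fun p (_ : p ∈ Finset.HasAntidiagonal.antidiagonal m) =>
      (functionalSubmodule k).smul_mem (m.choose p.1 : k) (res_mem p.1 p.2)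
  convert! h using 1
  funext L
  simp [H, H₂]

theorem hasDirDeriv_coord (v : Var) (L M : P2 k) :
    HasDirDeriv (fun L => coord L v) L M (coord M v) :=
  ⟨Polynomial.C (coord L v) + Polynomial.C (coord M v) * Polynomial.X,
    fun ε => by simp only [map_add, map_smul, Pi.add_apply, Pi.smul_apply, smul_eq_mul,
      Polynomial.eval_add, Polynomial.eval_mul, Polynomial.eval_C, Polynomial.eval_X, mul_comm],
    by simp⟩

end Functionals

section Poisson

variable {k : Type*} [Field k]

theorem res_mul_lie (L A B : P k) : res (L * ⁅A, B⁆) = res (A * ⁅B, L⁆) := by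
  rw [Ring.lie_def, Ring.lie_def, mul_sub, mul_sub, res_sub, res_sub, res_mul_comm L (A * B),
    mul_assoc, ← mul_assoc L, res_mul_comm (L * B)]

theorem plus_add_minus (L : P k) : plus L + minus L = L := add_sub_cancel _ _

theorem res_mul_minus (A Z : P k) : res (A * minus Z) = res (plus A * Z) := by
  calc res (A * minus Z) = res (plus A * minus Z) + res (minus A * minus Z) := by
        rw [← res_add, ← add_mul, plus_add_minus]
    _ = res (plus A * plus Z) + res (plus A * minus Z) := by
        rw [res_minus_mul_minus, res_plus_mul_plus, add_comm]
    _ = res (plus A * Z) := by rw [← res_add, ← mul_add, plus_add_minus]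

theorem res_mul_plus (A Z : P k) : res (A * plus Z) = res (minus A * Z) := by
  rw [res_mul_comm, ← res_mul_minus, res_mul_comm]

variable (k) in
/-- The projection `L ↦ L₊`, as a homomorphism. -/
noncomputable def plusHom : P k →+ P k where
  toFun := plus
  map_zero' := by
    ext1 n
    exact ite_self _
  map_add' L M := by
    ext1 n
    change (if 0 ≤ n then L.coeff n + M.coeff n else 0) =
      (if 0 ≤ n then L.coeff n else 0) + if 0 ≤ n then M.coeff n else 0
    split_ifs <;> simp

/-- The Hamiltonian vector field of `H_m`. -/
noncomputable def hamField (m : ℕ) (L : P2 k) : P2 k := vecField k (plusHom k) m L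

theorem pair_bracketR_gradH (m : ℕ) (L A : P2 k) :
    pair L (bracketR A (gradH k m L)) = pair (hamField m L) A := by
  refine Finset.sum_congr rfl fun i _ => ?_
  have hamField_apply : hamField m L i =
      minus ⁅plus (gradH k m L i), L i⁆ - plus ⁅minus (gradH k m L i), L i⁆ := rfl
  rw [hamField_apply, res_mul_comm _ (A i), bracketR]
  simp only [mul_sub, res_sub, res_mul_minus, res_mul_plus, res_mul_lie (L i)]

theorem poissonR_H [CharZero k] (F : P2 k → k) (m : ℕ) (L : P2 k) :
    poissonR F (H m) L = pair (hamField m L) (grad F L) := by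
  rw [poissonR, (isGradient_H m L).grad_eq, pair_bracketR_gradH]

theorem hasDirDeriv_hamField [CharZero k] {F : P2 k → k} (hF : F ∈ Functionals k) (m : ℕ)
    (L : P2 k) : HasDirDeriv F L (hamField m L) (poissonR F (H m) L) := by
  rw [poissonR_H]
  exact isGradient_grad hF L _

theorem commute_of_mem_PPrime {L : P2 k} (hL : L ∈ PPrime k) (i j : Fin 2) :
    Commute (L i) (L j) :=
  sub_eq_zero.1 (hL i j)

theorem hamField_eq_lax [CharZero k] {m : ℕ} (hm : m ≠ 0) {L : P2 k} (hL : L ∈ PPrime k) :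
    hamField m L = lax m L :=
  funext fun i => vecField_of_commute (plusHom k) hm (commute_of_mem_PPrime hL 0 1) i

theorem forall_hasDirDeriv_iff [CharZero k] {m : ℕ} (hm : m ≠ 0) {L : P2 k} (hL : L ∈ PPrime k)
    (X : P2 k) :
    (∀ F ∈ Functionals k, HasDirDeriv F L X (poissonR F (H m) L)) ↔ X = lax m L := by
  rw [← hamField_eq_lax hm hL]
  refine ⟨fun h => coord_injective (funext fun v => ?_), ?_⟩
  · have hX := (h _ (coord_mem_functionals v)).unique (hasDirDeriv_coord v L X)
    have hH := (hasDirDeriv_hamField (coord_mem_functionals v) m L).unique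
      (hasDirDeriv_coord v L (hamField m L))
    exact hX.symm.trans hH
  · rintro rfl F hF
    exact hasDirDeriv_hamField hF m L

theorem isTangent_lax (m : ℕ) {L : P2 k} (hL : L ∈ PPrime k) : IsTangent L (lax m L) := by
  intro i j
  have jacobi := (innerDeriv (plus ((L 0 + L 1) ^ (m - 1)))).lie (L i) (L j)
  rw [hL i j, map_zero] at jacobi
  exact jacobi.symm

theorem poissonR_H_H [CharZero k] {m m' : ℕ} (hm : m ≠ 0) (hm' : m' ≠ 0) {L : P2 k}
    (hL : L ∈ PPrime k) : poissonR (H m) (H m') L = 0 := by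
  have hc := commute_of_mem_PPrime hL 0 1
  have lie_eq_zero (i : Fin 2) : ⁅L i, gradH k m L i⁆ = 0 := by
    rw [gradH_of_commute hm hc, Ring.lie_def, (commute_add_pow hc (m - 1) i).eq, sub_self]
  rw [poissonR_H, (isGradient_H m L).grad_eq, hamField_eq_lax hm' hL]
  refine Finset.sum_eq_zero fun i _ => ?_
  rw [lax, res_mul_comm, res_mul_lie, lie_eq_zero, mul_zero]
  exact map_zero (resL (k := k))

end Poisson

section PowerSeries

variable {S A B : Type*} [Ring A] [Ring B]

theorem coeff_timeDeriv (s : S) (f : MvPowerSeries S A) (n : S →₀ ℕ) :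
    MvPowerSeries.coeff n (timeDeriv s f) =
      (n s + 1) • MvPowerSeries.coeff (n + Finsupp.single s 1) f := rfl

theorem sum_antidiagonal_add_single_left {M : Type*} [AddCommMonoid M] [DecidableEq S] (s : S)
    (n : S →₀ ℕ) (φ : (S →₀ ℕ) → (S →₀ ℕ) → M) :
    ∑ p ∈ Finset.HasAntidiagonal.antidiagonal (n + Finsupp.single s 1),
      (p.1 : S →₀ ℕ) s • φ p.1 p.2 =
      ∑ p ∈ Finset.HasAntidiagonal.antidiagonal n,
        ((p.1 : S →₀ ℕ) s + 1) • φ (p.1 + Finsupp.single s 1) p.2 := by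
  symm
  refine Finset.sum_of_injOn (fun p => (p.1 + Finsupp.single s 1, p.2)) ?_ ?_ ?_ fun p _ => by simp
  · rintro ⟨a, b⟩ _ ⟨a', b'⟩ _ h
    simpa using h
  · rintro ⟨a, b⟩ h
    simp only [Finset.mem_coe, Finset.HasAntidiagonal.mem_antidiagonal] at h ⊢
    rw [← h, add_right_comm]
  · rintro ⟨a, b⟩ hab not_mem
    suffices ha : a s = 0 by simp [ha]
    by_contra ha
    have hle : Finsupp.single s 1 ≤ a :=
      Finsupp.single_le_iff.2 (Nat.one_le_iff_ne_zero.2 ha)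
    refine not_mem ⟨(a - Finsupp.single s 1, b), ?_, by simp only [tsub_add_cancel_of_le hle]⟩
    simp only [Finset.mem_coe, Finset.HasAntidiagonal.mem_antidiagonal] at hab ⊢
    refine add_right_cancel (b := Finsupp.single s 1) ?_
    rw [add_right_comm, tsub_add_cancel_of_le hle, hab]

theorem sum_antidiagonal_add_single_right {M : Type*} [AddCommMonoid M] [DecidableEq S] (s : S)
    (n : S →₀ ℕ) (φ : (S →₀ ℕ) → (S →₀ ℕ) → M) :
    ∑ p ∈ Finset.HasAntidiagonal.antidiagonal (n + Finsupp.single s 1),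
      (p.2 : S →₀ ℕ) s • φ p.1 p.2 =
      ∑ p ∈ Finset.HasAntidiagonal.antidiagonal n,
        ((p.2 : S →₀ ℕ) s + 1) • φ p.1 (p.2 + Finsupp.single s 1) := by
  rw [Finsupp.sum_antidiagonal_swap _ fun a b => b s • φ a b,
    sum_antidiagonal_add_single_left s n fun a b => φ b a,
    Finsupp.sum_antidiagonal_swap n fun a b => (b s + 1) • φ a (b + Finsupp.single s 1)]

theorem timeDeriv_mul (s : S) (f g : MvPowerSeries S A) :
    timeDeriv s (f * g) = timeDeriv s f * g + f * timeDeriv s g := by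
  classical
  ext n
  have split : ∀ p ∈ Finset.HasAntidiagonal.antidiagonal (n + Finsupp.single s 1),
      (n s + 1) • (MvPowerSeries.coeff p.1 f * MvPowerSeries.coeff p.2 g) =
        p.1 s • (MvPowerSeries.coeff p.1 f * MvPowerSeries.coeff p.2 g) +
          p.2 s • (MvPowerSeries.coeff p.1 f * MvPowerSeries.coeff p.2 g) := by
    intro p hp
    rw [Finset.HasAntidiagonal.mem_antidiagonal] at hp
    rw [← add_smul, ← Finsupp.add_apply, hp, Finsupp.add_apply, Finsupp.single_eq_same]
  rw [coeff_timeDeriv, MvPowerSeries.coeff_mul, Finset.smul_sum, Finset.sum_congr rfl split,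
    Finset.sum_add_distrib,
    sum_antidiagonal_add_single_left s n fun a b =>
      MvPowerSeries.coeff a f * MvPowerSeries.coeff b g,
    sum_antidiagonal_add_single_right s n fun a b =>
      MvPowerSeries.coeff a f * MvPowerSeries.coeff b g,
    map_add, MvPowerSeries.coeff_mul, MvPowerSeries.coeff_mul]
  simp only [coeff_timeDeriv, smul_mul_assoc, mul_smul_comm]

variable (A) in
/-- The time derivative as a derivation of the ring of power series in the times. -/
noncomputable def timeDerivation (s : S) : RingDeriv (MvPowerSeries S A) where
  toFun := timeDeriv s
  map_zero' := by
    ext n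
    rw [coeff_timeDeriv, map_zero, smul_zero]
    rfl
  map_add' f g := by
    ext n
    rw [coeff_timeDeriv, map_add, smul_add]
    rfl
  leibniz' := timeDeriv_mul s

theorem coeff_eq_zero_of_timeDeriv [IsAddTorsionFree A] {f : MvPowerSeries S A} {s : S}
    {n : S →₀ ℕ} (hn : n s ≠ 0)
    (h : MvPowerSeries.coeff (n - Finsupp.single s 1) (timeDeriv s f) = 0) :
    MvPowerSeries.coeff n f = 0 := by
  have hle : Finsupp.single s 1 ≤ n := Finsupp.single_le_iff.2 (Nat.one_le_iff_ne_zero.2 hn)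
  rw [coeff_timeDeriv, tsub_add_cancel_of_le hle] at h
  exact (nsmul_eq_zero_iff_right (Nat.succ_ne_zero _)).1 h

/-- The coefficientwise extension of an additive map to power series. -/
def mapT (π : A →+ B) : MvPowerSeries S A →+ MvPowerSeries S B where
  toFun f := fun n => π (MvPowerSeries.coeff n f)
  map_zero' := by
    funext
    exact map_zero π
  map_add' f g := by
    funext
    exact map_add π _ _

theorem timeDeriv_mapT (π : A →+ B) (s : S) (f : MvPowerSeries S A) :
    timeDeriv s (mapT π f) = mapT π (timeDeriv s f) :=
  funext fun n => (map_nsmul π (n s + 1) _).symm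

end PowerSeries

section Congruence

variable {S A B : Type*} [Ring A] [Ring B]

/-- Congruence of power series: equality of the coefficients in a lower set of exponents. -/
def lowerCon (A : Type*) [Ring A] (D : LowerSet (S →₀ ℕ)) : RingCon (MvPowerSeries S A) where
  r f g := ∀ n ∈ D, MvPowerSeries.coeff n f = MvPowerSeries.coeff n g
  iseqv := ⟨fun _ _ _ => rfl, fun h n hn => (h n hn).symm, fun h h' n hn =>
    (h n hn).trans (h' n hn)⟩
  add' h h' n hn := by
    rw [map_add, map_add, h n hn, h' n hn]
  mul' h h' n hn := by
    classical
    rw [MvPowerSeries.coeff_mul, MvPowerSeries.coeff_mul]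
    refine Finset.sum_congr rfl fun p hp => ?_
    rw [Finset.HasAntidiagonal.mem_antidiagonal] at hp
    rw [h p.1 (D.lower (le_self_add.trans hp.le) hn),
      h' p.2 (D.lower (le_add_self.trans hp.le) hn)]

theorem lowerCon_mapT (π : A →+ B) {D : LowerSet (S →₀ ℕ)} {f g : MvPowerSeries S A}
    (h : lowerCon A D f g) : lowerCon B D (mapT π f) (mapT π g) :=
  fun n hn => congrArg π (h n hn)

/-- The map induced by `mapT` on power series modulo `lowerCon`. -/
noncomputable def mapMod (D : LowerSet (S →₀ ℕ)) (π : A →+ A) :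
    (lowerCon A D).Quotient →+ (lowerCon A D).Quotient :=
  (lowerCon A D).toAddCon.lift ((lowerCon A D).mk'.toAddMonoidHom.comp (mapT π)) fun _ _ h =>
    (lowerCon A D).eq.2 (lowerCon_mapT π h)

theorem ringCon_binomSum (C : RingCon A) (m : ℕ) {x y : Fin 2 → A} (h : ∀ i, C (x i) (y i)) :
    C (binomSum m x) (binomSum m y) :=
  C.eq.1 <| (map_binomSum C.mk' m x).trans <|
    (congrArg (binomSum m) (funext fun i => C.eq.2 (h i))).trans (map_binomSum C.mk' m y).symm

theorem ringCon_monoAt {σ R : Type*} [CommRing R] (C : RingCon R) (μ : σ →₀ ℕ) {x y : σ → R}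
    (h : ∀ v, C (x v) (y v)) : C (monoAt μ x) (monoAt μ y) :=
  C.eq.1 <| (map_monoAt C.mk' μ x).trans <|
    (congrArg (monoAt μ) (funext fun v => C.eq.2 (h v))).trans (map_monoAt C.mk' μ y).symm

theorem ringCon_dmonoAt {σ R : Type*} [CommRing R] (C : RingCon R) (μ : σ →₀ ℕ) {x y z w : σ → R}
    (hxy : ∀ v, C (x v) (y v)) (hzw : ∀ v, C (z v) (w v)) :
    C (dmonoAt μ x z) (dmonoAt μ y w) :=
  C.eq.1 <| (map_dmonoAt C.mk' μ x z).trans <|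
    (congrArg₂ (dmonoAt μ) (funext fun v => C.eq.2 (hxy v)) (funext fun v => C.eq.2 (hzw v))).trans
      (map_dmonoAt C.mk' μ y w).symm

variable {k : Type*} [Field k] [Algebra k A]

theorem mk_vecField (D : LowerSet (S →₀ ℕ)) (π : A →+ A) (m : ℕ) (x : Fin 2 → MvPowerSeries S A)
    (i : Fin 2) : (lowerCon A D).mk' (vecField k (mapT π) m x i) =
      vecField k (mapMod D π) m (fun i => (lowerCon A D).mk' (x i)) i :=
  map_vecField _ (fun _ _ => rfl) (fun _ => rfl) m x i

theorem lowerCon_vecField (π : A →+ A) (m : ℕ) {D : LowerSet (S →₀ ℕ)}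
    {x y : Fin 2 → MvPowerSeries S A} (h : ∀ i, lowerCon A D (x i) (y i)) (i : Fin 2) :
    lowerCon A D (vecField k (mapT π) m x i) (vecField k (mapT π) m y i) := by
  refine (lowerCon A D).eq.1 ((mk_vecField D π m x i).trans (Eq.trans ?_
    (mk_vecField D π m y i).symm))
  congr 1
  exact funext fun j => (lowerCon A D).eq.2 (h j)

end Congruence

section TimePolynomials

variable {S A B : Type*} [Ring A] [Ring B]

/-- The polynomials in the times with coefficients in `A`. `MvPolynomial` is not available since
`A` need not be commutative. -/
abbrev TimePoly (S A : Type*) [Ring A] : Type _ := AddMonoidAlgebra A (S →₀ ℕ)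

variable (S A) in
/-- The power series of a polynomial in the times. -/
noncomputable def toSeries : TimePoly S A →+* MvPowerSeries S A where
  toFun f := fun n => f.coeff n
  map_zero' := rfl
  map_one' := by
    classical
    ext n
    rw [MvPowerSeries.coeff_one]
    change (1 : TimePoly S A).coeff n = _
    rw [AddMonoidAlgebra.one_def, AddMonoidAlgebra.coeff_single, Finsupp.single_apply]
    simp only [eq_comm]
  map_add' _ _ := rfl
  map_mul' f g := by
    classical
    ext n
    exact (AddMonoidAlgebra.coeff_mul_antidiag f g n _
      Finset.HasAntidiagonal.mem_antidiagonal).trans (MvPowerSeries.coeff_mul n _ _).symm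

variable (S) in
/-- The coefficientwise extension of an additive map to polynomials in the times. -/
noncomputable def mapPoly (π : A →+ B) : TimePoly S A →+ TimePoly S B where
  toFun := AddMonoidAlgebra.map π
  map_zero' := by
    ext
    exact map_zero π
  map_add' f g := by
    ext
    exact map_add π _ _

theorem mapPoly_single (π : A →+ B) (n : S →₀ ℕ) (a : A) :
    mapPoly S π (AddMonoidAlgebra.single n a) = AddMonoidAlgebra.single n (π a) :=
  AddMonoidAlgebra.map_single ..

/-- The truncation of a power series to the exponents at most `n`. -/
noncomputable def trunc [DecidableEq S] (n : S →₀ ℕ) (f : MvPowerSeries S A) : TimePoly S A :=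
  ∑ j ∈ Finset.Icc 0 n, AddMonoidAlgebra.single j (MvPowerSeries.coeff j f)

theorem lowerCon_trunc [DecidableEq S] (n : S →₀ ℕ) (f : MvPowerSeries S A) :
    lowerCon A (LowerSet.Iic n) (toSeries S A (trunc n f)) f := by
  intro j hj
  change (trunc n f).coeff j = _
  rw [trunc, AddMonoidAlgebra.coeff_sum, Finsupp.finsetSum_apply]
  simp only [AddMonoidAlgebra.coeff_single, Finsupp.single_apply, Finset.sum_ite_eq',
    Finset.mem_Icc, zero_le, true_and, if_pos (LowerSet.mem_Iic_iff.1 hj)]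

variable {k : Type*} [Field k] [Algebra k A] [Algebra k B]

variable (A) in
/-- The value of a polynomial in the times at given times. -/
noncomputable def evalPoly (ε : S → k) : TimePoly S A →ₐ[k] A :=
  AddMonoidAlgebra.liftNCAlgHom (AlgHom.id k A)
    { toFun := fun n => algebraMap k A (n.toAdd.prod fun s e => ε s ^ e)
      map_one' := by simp
      map_mul' := fun a b => by
        rw [toAdd_mul, Finsupp.prod_add_index' (fun _ => pow_zero _) fun _ _ _ => pow_add _ _ _,
          map_mul] }
    fun a _ => (Algebra.commutes _ a).symm

theorem evalPoly_single (ε : S → k) (n : S →₀ ℕ) (a : A) :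
    evalPoly A ε (AddMonoidAlgebra.single n a) = (n.prod fun s e => ε s ^ e) • a := by
  refine (AddMonoidAlgebra.liftNC_single _ _ _ _).trans ?_
  rw [Algebra.smul_def, Algebra.commutes]
  rfl

theorem evalPoly_mvPolynomial (ε : S → k) (p : MvPolynomial S k) :
    evalPoly k ε p = MvPolynomial.eval ε p := by
  induction p using AddMonoidAlgebra.induction_linear with
  | zero => exact (map_zero _).trans (map_zero _).symm
  | add x y hx hy => exact (map_add _ x y).trans (hx ▸ hy ▸ (map_add _ x y).symm)
  | single n a =>
    exact (evalPoly_single ε n a).trans ((mul_comm _ _).trans (MvPolynomial.eval_monomial).symm)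

theorem evalPoly_mapPoly (ε : S → k) {π : A →+ B} (hπ : ∀ (c : k) a, π (c • a) = c • π a)
    (f : TimePoly S A) : evalPoly B ε (mapPoly S π f) = π (evalPoly A ε f) := by
  induction f using AddMonoidAlgebra.induction_linear with
  | zero => simp only [map_zero]
  | add x y hx hy => simp only [map_add, hx, hy]
  | single n a => rw [mapPoly_single, evalPoly_single, evalPoly_single, hπ]

end TimePolynomials

section FormalCurves

variable {k : Type*} [Field k] {S : Type*}

theorem IsValue.unique [CharZero k] {F : P2 k → k} {L : Fin 2 → MvPowerSeries S (P k)}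
    {f g : MvPowerSeries S k} (hf : IsValue F L f) (hg : IsValue F L g) : f = g := by
  ext n
  obtain ⟨p, hp, hfp⟩ := hf n
  obtain ⟨q, hq, hgq⟩ := hg n
  rw [hfp, hgq, MvPolynomial.funext fun ε => (hp ε).symm.trans (hq ε)]

theorem isValue_finsum {ι : Type*} {F : P2 k → k} {L : Fin 2 → MvPowerSeries S (P k)} {c : ι → k}
    {w : ι → MvPowerSeries S k} {u : (S →₀ ℕ) → ι → MvPolynomial S k}
    (finite_ne_zero : ∀ n, {i | c i ≠ 0 ∧ u n i ≠ 0}.Finite)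
    (eval_eq : ∀ n ε, F (truncAt L n ε) = ∑ᶠ i, c i * MvPolynomial.eval ε (u n i))
    (coeff_eq : ∀ n i, MvPolynomial.coeff n (u n i) = MvPowerSeries.coeff n (w i)) :
    IsValue F L fun n => ∑ᶠ i, c i * MvPowerSeries.coeff n (w i) := by
  intro n
  obtain ⟨p, hp⟩ := exists_forall_finsum_mul_eq (finite_ne_zero n)
  refine ⟨p, fun ε => (eval_eq n ε).trans (hp (MvPolynomial.aeval ε).toLinearMap), ?_⟩
  exact (finsum_congr fun i => by rw [← coeff_eq]; rfl).trans (hp (MvPolynomial.lcoeff k n))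

theorem evalPoly_trunc [DecidableEq S] (L : Fin 2 → MvPowerSeries S (P k)) (n : S →₀ ℕ) (ε : S → k)
    (i : Fin 2) : evalPoly (P k) ε (trunc n (L i)) = truncAt L n ε i := by
  unfold trunc truncAt
  rw [map_sum]
  refine Finset.sum_congr ?_ fun j _ => evalPoly_single ε j _
  congr!

/-- The coefficients of a pair of polynomials in the times. -/
noncomputable def coordPoly : (Fin 2 → TimePoly S (P k)) →+ Var → MvPolynomial S k where
  toFun q v := mapPoly S (entryL v.2).toAddMonoidHom (q v.1)
  map_zero' := funext fun _ => map_zero _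
  map_add' _ _ := funext fun _ => map_add _ _ _

theorem eval_coordPoly (q : Fin 2 → TimePoly S (P k)) (v : Var) (ε : S → k) :
    MvPolynomial.eval ε (coordPoly q v) = coord (fun i => evalPoly (P k) ε (q i)) v :=
  (evalPoly_mvPolynomial ε _).symm.trans (evalPoly_mapPoly ε (map_smul (entryL v.2)) (q v.1))

theorem eval_coordPoly_trunc [DecidableEq S] (L : Fin 2 → MvPowerSeries S (P k)) (n : S →₀ ℕ)
    (v : Var) (ε : S → k) :
    MvPolynomial.eval ε (coordPoly (fun i => trunc n (L i)) v) = coord (truncAt L n ε) v := by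
  simp only [eval_coordPoly, evalPoly_trunc]

theorem coordPoly_single (n : S →₀ ℕ) (L : P2 k) :
    coordPoly (fun i => AddMonoidAlgebra.single n (L i)) =
      MvPolynomial.monomial n (1 : k) • fun v => algebraMap k (MvPolynomial S k) (coord L v) :=
  funext fun v => (mapPoly_single _ n (L v.1)).trans <| by
    rw [Pi.smul_apply, smul_eq_mul, mul_comm, MvPolynomial.algebraMap_eq,
      MvPolynomial.C_mul_monomial, mul_one]
    rfl

theorem coordPoly_mem_points (q : Fin 2 → TimePoly S (P k)) :
    coordPoly q ∈ points k (MvPolynomial S k) := by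
  have pi_single_mem : ∀ i (f : TimePoly S (P k)),
      coordPoly (Pi.single i f) ∈ points k (MvPolynomial S k) := by
    intro i f
    induction f using AddMonoidAlgebra.induction_linear with
    | zero =>
      rw [Pi.single_zero, map_zero]
      exact Submodule.zero_mem _
    | add x y hx hy =>
      rw [Pi.single_add, map_add]
      exact Submodule.add_mem _ hx hy
    | single n a =>
      have : Pi.single i (AddMonoidAlgebra.single n a) =
          fun j => AddMonoidAlgebra.single n ((Pi.single i a : P2 k) j) :=
        Pi.single_op (M := fun _ => P k) (fun _ => AddMonoidAlgebra.single n)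
          (fun _ => AddMonoidAlgebra.single_zero n) i a
      rw [this, coordPoly_single]
      exact Submodule.smul_mem _ _ (algebraMap_coord_mem_points _)
  rw [← Finset.univ_sum_single q, map_sum]
  exact Submodule.sum_mem _ fun i _ => pi_single_mem i (q i)

/-- The coefficients of a formal curve in `P²`. -/
noncomputable def coordT (L : Fin 2 → MvPowerSeries S (P k)) (v : Var) : MvPowerSeries S k :=
  mapT (entryL v.2).toAddMonoidHom (L v.1)

theorem coe_coordPoly (q : Fin 2 → TimePoly S (P k)) (v : Var) :
    (coordPoly q v : MvPowerSeries S k) = coordT (fun i => toSeries S (P k) (q i)) v := rfl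

theorem coordT_injective : Function.Injective
    (coordT : (Fin 2 → MvPowerSeries S (P k)) → Var → MvPowerSeries S k) := fun _ _ h =>
  funext fun i => funext fun n =>
    P.entry_ext fun e => congrArg (MvPowerSeries.coeff n) (congrFun h (i, e))

theorem lowerCon_coordPoly_trunc [DecidableEq S] (L : Fin 2 → MvPowerSeries S (P k))
    (n : S →₀ ℕ) (v : Var) :
    lowerCon k (LowerSet.Iic n) (coordPoly (fun i => trunc n (L i)) v) (coordT L v) :=
  lowerCon_mapT _ (lowerCon_trunc n (L v.1))

theorem coeff_eq_of_lowerCon_Iic {n : S →₀ ℕ} {p : MvPolynomial S k} {f : MvPowerSeries S k}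
    (h : lowerCon k (LowerSet.Iic n) p f) : MvPolynomial.coeff n p = MvPowerSeries.coeff n f :=
  h n (LowerSet.mem_Iic_iff.2 le_rfl)

theorem coeff_monoAt_congr {n : S →₀ ℕ} {x : Var → MvPolynomial S k}
    {X : Var → MvPowerSeries S k} (hx : ∀ v, lowerCon k (LowerSet.Iic n) (x v) (X v))
    (μ : Var →₀ ℕ) :
    MvPolynomial.coeff n (monoAt μ x) = MvPowerSeries.coeff n (monoAt μ X) := by
  refine coeff_eq_of_lowerCon_Iic ?_
  rw [← MvPolynomial.coeToMvPowerSeries.ringHom_apply, map_monoAt]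
  exact ringCon_monoAt _ μ hx

theorem coeff_dmonoAt_congr {n : S →₀ ℕ} {x z : Var → MvPolynomial S k}
    {X Z : Var → MvPowerSeries S k} (hx : ∀ v, lowerCon k (LowerSet.Iic n) (x v) (X v))
    (hz : ∀ v, lowerCon k (LowerSet.Iic n) (z v) (Z v)) (μ : Var →₀ ℕ) :
    MvPolynomial.coeff n (dmonoAt μ x z) = MvPowerSeries.coeff n (dmonoAt μ X Z) := by
  refine coeff_eq_of_lowerCon_Iic ?_
  rw [← MvPolynomial.coeToMvPowerSeries.ringHom_apply, map_dmonoAt]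
  exact ringCon_dmonoAt _ μ hx hz

theorem isValue_ofCoeff [CharZero k] {c : (Var →₀ ℕ) → k}
    (hc : IsFunctionalCoeff c) (L : Fin 2 → MvPowerSeries S (P k)) :
    IsValue (ofCoeff c) L fun n => ∑ᶠ μ, c μ * MvPowerSeries.coeff n (monoAt μ (coordT L)) := by
  classical
  refine isValue_finsum (fun n => hc.finite_monoAt_ne_zero (coordPoly_mem_points _))
    (fun n ε => ?_) fun n => coeff_monoAt_congr (lowerCon_coordPoly_trunc L n)
  simp only [map_monoAt, eval_coordPoly_trunc]
  rfl

theorem isValue_coord (v : Var) (L : Fin 2 → MvPowerSeries S (P k)) :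
    IsValue (fun L => coord L v) L (coordT L v) := by
  classical
  exact fun n => ⟨_, fun ε => (eval_coordPoly_trunc L n v ε).symm,
    (coeff_eq_of_lowerCon_Iic (lowerCon_coordPoly_trunc L n v)).symm⟩

end FormalCurves

section HamiltonianFlow

variable {k : Type*} [Field k] {S : Type*}

theorem plusHom_smul (c : k) (L : P k) : plusHom k (c • L) = c • plusHom k L := by
  ext1 n
  change (if 0 ≤ n then c • L.coeff n else 0) = c • (if 0 ≤ n then L.coeff n else 0)
  split_ifs <;> simp

/-- The Hamiltonian vector field of `H_m` along a formal curve. -/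
noncomputable def hamFieldT (m : ℕ) (L : Fin 2 → MvPowerSeries S (P k)) :
    Fin 2 → MvPowerSeries S (P k) :=
  vecField k (mapT (plusHom k)) m L

/-- The Hamiltonian vector field of `H_m` along a pair of polynomials in the times. -/
noncomputable def hamFieldPoly (m : ℕ) (q : Fin 2 → TimePoly S (P k)) :
    Fin 2 → TimePoly S (P k) :=
  vecField k (mapPoly S (plusHom k)) m q

theorem evalPoly_hamFieldPoly (m : ℕ) (q : Fin 2 → TimePoly S (P k)) (ε : S → k) (i : Fin 2) :
    evalPoly (P k) ε (hamFieldPoly m q i) = hamField m (fun i => evalPoly (P k) ε (q i)) i :=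
  map_vecField (evalPoly (P k) ε).toRingHom (map_smul (evalPoly (P k) ε))
    (evalPoly_mapPoly ε plusHom_smul) m q i

theorem toSeries_hamFieldPoly (m : ℕ) (q : Fin 2 → TimePoly S (P k)) (i : Fin 2) :
    toSeries S (P k) (hamFieldPoly m q i) = hamFieldT m (fun i => toSeries S (P k) (q i)) i :=
  map_vecField (toSeries S (P k)) (fun _ _ => rfl) (fun _ => rfl) m q i

theorem eval_coordPoly_hamFieldPoly_trunc [DecidableEq S] (m : ℕ)
    (L : Fin 2 → MvPowerSeries S (P k)) (n : S →₀ ℕ) (v : Var) (ε : S → k) :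
    MvPolynomial.eval ε (coordPoly (hamFieldPoly m fun i => trunc n (L i)) v) =
      coord (hamField m (truncAt L n ε)) v := by
  simp only [eval_coordPoly, evalPoly_hamFieldPoly, evalPoly_trunc]

theorem lowerCon_coordPoly_hamFieldPoly_trunc [DecidableEq S] (m : ℕ)
    (L : Fin 2 → MvPowerSeries S (P k)) (n : S →₀ ℕ) (v : Var) :
    lowerCon k (LowerSet.Iic n) (coordPoly (hamFieldPoly m fun i => trunc n (L i)) v)
      (coordT (hamFieldT m L) v) := by
  rw [coe_coordPoly]
  simp only [toSeries_hamFieldPoly]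
  exact lowerCon_mapT _ (lowerCon_vecField (plusHom k) m (fun i => lowerCon_trunc n (L i)) v.1)

theorem isValue_poissonR_ofCoeff [CharZero k] {c : (Var →₀ ℕ) → k} (hc : IsFunctionalCoeff c)
    (m : ℕ) (L : Fin 2 → MvPowerSeries S (P k)) :
    IsValue (poissonR (ofCoeff c) (H m)) L fun n =>
      ∑ᶠ μ, c μ * MvPowerSeries.coeff n (dmonoAt μ (coordT L) (coordT (hamFieldT m L))) := by
  classical
  refine isValue_finsum
    (fun n => hc.finite_dmonoAt_ne_zero (coordPoly_mem_points _) (coordPoly_mem_points _))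
    (fun n ε => ?_) fun n => coeff_dmonoAt_congr (lowerCon_coordPoly_trunc L n)
      (lowerCon_coordPoly_hamFieldPoly_trunc m L n)
  simp only [map_dmonoAt, eval_coordPoly_trunc, eval_coordPoly_hamFieldPoly_trunc]
  exact (hasDirDeriv_hamField (mem_functionals_iff.2 ⟨c, hc, rfl⟩) m _).unique (hc.hasDirDeriv _ _)

theorem isValue_poissonR_coord [CharZero k] (v : Var) (m : ℕ)
    (L : Fin 2 → MvPowerSeries S (P k)) :
    IsValue (poissonR (fun L => coord L v) (H m)) L (coordT (hamFieldT m L) v) := by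
  classical
  refine fun n => ⟨_, fun ε => ?_,
    (coeff_eq_of_lowerCon_Iic (lowerCon_coordPoly_hamFieldPoly_trunc m L n v)).symm⟩
  rw [eval_coordPoly_hamFieldPoly_trunc]
  exact (hasDirDeriv_hamField (coord_mem_functionals v) m _).unique (hasDirDeriv_coord v _ _)

theorem timeDeriv_monoAt_coordT {s : S} {L M : Fin 2 → MvPowerSeries S (P k)}
    (h : ∀ i, timeDeriv s (L i) = M i) (μ : Var →₀ ℕ) :
    timeDeriv s (monoAt μ (coordT L)) = dmonoAt μ (coordT L) (coordT M) := by
  refine ((timeDerivation k s).map_monoAt μ (coordT L)).trans (congrArg _ (funext fun v => ?_))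
  exact (timeDeriv_mapT _ s (L v.1)).trans (congrArg _ (h v.1))

theorem isHamiltonSolution_iff [CharZero k] (m : ℕ) (s : S) (L : Fin 2 → MvPowerSeries S (P k)) :
    IsHamiltonSolution (H m) s L ↔ ∀ i, timeDeriv s (L i) = hamFieldT m L i := by
  constructor
  · intro h
    refine congrFun (coordT_injective (funext fun v => ?_))
    obtain ⟨f, g, hf, hg, hfg⟩ := h _ (coord_mem_functionals v)
    rw [hf.unique (isValue_coord v L), hg.unique (isValue_poissonR_coord v m L)] at hfg
    exact (timeDeriv_mapT _ s (L v.1)).symm.trans hfg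
  · intro h F hF
    obtain ⟨c, hc, rfl⟩ := mem_functionals_iff.1 hF
    refine ⟨_, _, isValue_ofCoeff hc L, isValue_poissonR_ofCoeff hc m L, funext fun n => ?_⟩
    refine (smul_finsum _ _).trans (finsum_congr fun μ => ?_)
    rw [← timeDeriv_monoAt_coordT h, coeff_timeDeriv, mul_smul_comm]

theorem isHamiltonSolution_iff_isLaxSolution [CharZero k] {m : ℕ} (hm : m ≠ 0) (s : S)
    {L : Fin 2 → MvPowerSeries S (P k)} (hL : InPPrimeT L) :
    IsHamiltonSolution (H m) s L ↔ IsLaxSolution m s L := by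
  rw [isHamiltonSolution_iff]
  refine forall_congr' fun i => ?_
  rw [hamFieldT, vecField_of_commute _ hm (commute_iff_lie_eq.2 (hL 0 1))]
  rfl

end HamiltonianFlow

section InvarianceAndIntegrals

variable {k : Type*} [Field k] {S : Type*}

theorem lowerCon_timeDeriv_lie [CharZero k] {m : ℕ} (hm : m ≠ 0) {s : S}
    {L : Fin 2 → MvPowerSeries S (P k)} (h : IsHamiltonSolution (H m) s L)
    {D : LowerSet (S →₀ ℕ)} (hD : lowerCon (P k) D ⁅L 0, L 1⁆ 0) :
    lowerCon (P k) D (timeDeriv s ⁅L 0, L 1⁆) 0 := by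
  let φ := (lowerCon (P k) D).mk'
  let W := mapMod D (plusHom k) ((φ (L 0) + φ (L 1)) ^ (m - 1))
  have map_lie : ∀ f g, φ ⁅f, g⁆ = ⁅φ f, φ g⁆ := fun f g => by
    simp only [Ring.lie_def, map_sub, map_mul]
  have lie_eq_zero : ⁅φ (L 0), φ (L 1)⁆ = 0 :=
    (map_lie _ _).symm.trans (((lowerCon (P k) D).eq.2 hD).trans (map_zero φ))
  have lax_eq : ∀ i, φ (timeDeriv s (L i)) = ⁅W, φ (L i)⁆ := fun i => by
    rw [(isHamiltonSolution_iff m s L).1 h i]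
    exact (mk_vecField D _ m L i).trans
      (vecField_of_commute _ hm (commute_iff_lie_eq.2 lie_eq_zero) i)
  have timeDeriv_lie_eq : φ (timeDeriv s ⁅L 0, L 1⁆) = ⁅W, ⁅φ (L 0), φ (L 1)⁆⁆ := by
    refine (congrArg φ ((timeDerivation (P k) s).lie (L 0) (L 1))).trans ?_
    rw [map_add, map_lie, map_lie]
    refine Eq.trans ?_ ((innerDeriv W).lie _ _).symm
    exact congrArg₂ (⁅·, φ (L 1)⁆ + ⁅φ (L 0), ·⁆) (lax_eq 0) (lax_eq 1)
  rw [lie_eq_zero] at timeDeriv_lie_eq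
  exact (lowerCon (P k) D).eq.1
    (timeDeriv_lie_eq.trans ((map_zero (innerDeriv W)).trans (map_zero φ).symm))

/-- The exponents of degree less than `n`. -/
def degreeLT (S : Type*) (n : ℕ) : LowerSet (S →₀ ℕ) where
  carrier := {j | j.degree < n}
  lower' := fun _ _ h h' => lt_of_le_of_lt (Finsupp.degree_mono h) h'

theorem eq_zero_of_lowerCon_timeDeriv {A : Type*} [Ring A] [IsAddTorsionFree A]
    {f : MvPowerSeries S A} (h0 : MvPowerSeries.coeff 0 f = 0)
    (h : ∀ D, lowerCon A D f 0 → ∀ s, lowerCon A D (timeDeriv s f) 0) : f = 0 := by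
  have lowerCon_degreeLT : ∀ n, lowerCon A (degreeLT S n) f 0 := by
    intro n
    induction n with
    | zero => exact fun j hj => absurd hj (Nat.not_lt_zero _)
    | succ n ih =>
      intro j (hj : j.degree < n + 1)
      rcases eq_or_ne j 0 with rfl | hj0
      · exact h0
      obtain ⟨s, hs⟩ := Finsupp.ne_iff.1 hj0
      have hdeg := congrArg Finsupp.degree
        (tsub_add_cancel_of_le (Finsupp.single_le_iff.2 (Nat.one_le_iff_ne_zero.2 hs)))
      rw [map_add, Finsupp.degree_single] at hdeg
      refine coeff_eq_zero_of_timeDeriv hs (h _ ih s _ ?_)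
      change (j - Finsupp.single s 1).degree < n
      omega
  exact funext fun n => lowerCon_degreeLT (n.degree + 1) n (Nat.lt_succ_self _)

theorem inPPrimeT_of_isHamiltonSolution [CharZero k] {m : S → ℕ} (hm : ∀ s, m s ≠ 0)
    {L : Fin 2 → MvPowerSeries S (P k)} (h : ∀ s, IsHamiltonSolution (H (m s)) s L)
    (h0 : (fun i => MvPowerSeries.coeff 0 (L i)) ∈ PPrime k) : InPPrimeT L := by
  have : IsAddTorsionFree (P k) := ⟨fun n hn a b hab => smul_right_injective (P k)
    (Nat.cast_ne_zero.2 hn : (n : k) ≠ 0) (by simpa only [Nat.cast_smul_eq_nsmul] using hab)⟩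
  have lie_eq_zero : ⁅L 0, L 1⁆ = 0 := eq_zero_of_lowerCon_timeDeriv
    (by simpa only [Ring.lie_def, map_sub, map_mul,
      MvPowerSeries.coeff_zero_eq_constantCoeff_apply] using h0 0 1)
    fun D hD s => lowerCon_timeDeriv_lie (hm s) (h s) hD
  intro i j
  fin_cases i <;> fin_cases j
  · exact sub_self _
  · exact lie_eq_zero
  · exact commute_iff_lie_eq.1 (commute_iff_lie_eq.2 lie_eq_zero).symm
  · exact sub_self _

theorem res_coeff_mul_comm (f g : MvPowerSeries S (P k)) (n : S →₀ ℕ) :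
    res (MvPowerSeries.coeff n (f * g)) = res (MvPowerSeries.coeff n (g * f)) := by
  classical
  rw [MvPowerSeries.coeff_mul, MvPowerSeries.coeff_mul]
  refine (map_sum resL _ _).trans (Eq.trans ?_ (map_sum resL _ _).symm)
  rw [Finsupp.sum_antidiagonal_swap n fun a b =>
    resL (MvPowerSeries.coeff a f * MvPowerSeries.coeff b g)]
  exact Finset.sum_congr rfl fun p _ => res_mul_comm _ _

/-- The Hamiltonian `H_m` along a formal curve. -/
noncomputable def hamiltonianT (m : ℕ) (L : Fin 2 → MvPowerSeries S (P k)) : MvPowerSeries S k :=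
  mapT ((1 / (m : k)) • resL).toAddMonoidHom (binomSum m L)

theorem isValue_H (m : ℕ) (L : Fin 2 → MvPowerSeries S (P k)) :
    IsValue (H m) L (hamiltonianT m L) := by
  classical
  intro n
  let q : Fin 2 → TimePoly S (P k) := fun i => trunc n (L i)
  let ℓ : P k →ₗ[k] k := (1 / (m : k)) • resL
  refine ⟨mapPoly S ℓ.toAddMonoidHom (binomSum m q), fun ε => ?_, ?_⟩
  · rw [← evalPoly_mvPolynomial, H_eq, ← funext fun i => evalPoly_trunc L n ε i]
    exact (congrArg ℓ (map_binomSum (evalPoly (P k) ε).toRingHom m q)).symm.trans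
      (evalPoly_mapPoly ε (π := ℓ.toAddMonoidHom) (map_smul ℓ) (binomSum m q)).symm
  · have h : lowerCon (P k) (LowerSet.Iic n) (toSeries S (P k) (binomSum m q)) (binomSum m L) := by
      rw [map_binomSum]
      exact ringCon_binomSum _ m fun i => lowerCon_trunc n (L i)
    exact (coeff_eq_of_lowerCon_Iic (lowerCon_mapT ℓ.toAddMonoidHom h)).symm

theorem timeDeriv_binomSum {m : ℕ} {s : S} {L : Fin 2 → MvPowerSeries S (P k)}
    (h : IsLaxSolution m s L) (m' : ℕ) :
    timeDeriv s (binomSum m' L) = ⁅plusT ((L 0 + L 1) ^ (m - 1)), binomSum m' L⁆ := by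
  refine ((timeDerivation (P k) s).binomSum m' L).trans (Eq.trans ?_
    ((innerDeriv (plusT ((L 0 + L 1) ^ (m - 1)))).binomSum m' L).symm)
  rw [show timeDerivation (P k) s (L 0) = _ from h 0,
    show timeDerivation (P k) s (L 1) = _ from h 1]
  rfl

theorem timeDeriv_hamiltonianT_eq_zero {m : ℕ} {s : S} {L : Fin 2 → MvPowerSeries S (P k)}
    (h : IsLaxSolution m s L) (m' : ℕ) : timeDeriv s (hamiltonianT m' L) = 0 := by
  rw [hamiltonianT, timeDeriv_mapT, timeDeriv_binomSum h]
  ext n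
  change (1 / (m' : k)) * res (MvPowerSeries.coeff n
    ⁅plusT ((L 0 + L 1) ^ (m - 1)), binomSum m' L⁆) = 0
  rw [Ring.lie_def, map_sub, res_sub, res_coeff_mul_comm, sub_self, mul_zero]

end InvarianceAndIntegrals

end PDO

theorem proposition9 {k : Type*} [Field k] [CharZero k] :
    -- the functionals `H_m` belong to `𝓕(P²)`, and all functionals have unique gradients
    (∀ F ∈ PDO.Functionals k, ∀ L : PDO.P2 k, ∃! U, PDO.IsGradient F L U) ∧
    (∀ m : ℕ+, (PDO.H m : PDO.P2 k → k) ∈ PDO.Functionals k) ∧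
    -- (i), infinitesimally: at a point of `P'` the system is given by exactly one velocity vector,
    -- the right-hand side of the Lax equations, and this vector is tangent to `P'`
    (∀ m : ℕ+, ∀ L ∈ PDO.PPrime k,
      (∀ X : PDO.P2 k,
        (∀ F ∈ PDO.Functionals k, PDO.HasDirDeriv F L X (PDO.poissonR F (PDO.H m) L)) ↔
          X = PDO.lax m L) ∧
      PDO.IsTangent L (PDO.lax m L)) ∧
    -- (i), for formal solutions in any set `T` of the times `t_m`: solutions that start in `P'`
    -- stay in `P'`
    (∀ (T : Set ℕ+) (L : Fin 2 → MvPowerSeries T (PDO.P k)),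
      (∀ s : T, PDO.IsHamiltonSolution (PDO.H (s : ℕ+)) s L) →
      (fun i => MvPowerSeries.coeff 0 (L i)) ∈ PDO.PPrime k → PDO.InPPrimeT L) ∧
    -- (i), for formal curves in `P'`: the system is equivalent to the Lax equations
    (∀ (T : Set ℕ+) (L : Fin 2 → MvPowerSeries T (PDO.P k)), PDO.InPPrimeT L →
      ∀ s : T, PDO.IsHamiltonSolution (PDO.H (s : ℕ+)) s L ↔ PDO.IsLaxSolution (s : ℕ+) s L) ∧
    -- (ii), integrals of motion: each `H_m` is constant along the solutions that start in `P'`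
    (∀ (T : Set ℕ+) (L : Fin 2 → MvPowerSeries T (PDO.P k)),
      (∀ s : T, PDO.IsHamiltonSolution (PDO.H (s : ℕ+)) s L) →
      (fun i => MvPowerSeries.coeff 0 (L i)) ∈ PDO.PPrime k →
      ∀ m : ℕ+, ∃ f : MvPowerSeries T k, PDO.IsValue (PDO.H m) L f ∧
        ∀ s : T, PDO.timeDeriv s f = 0) ∧
    -- (ii), the functionals `H_m` Poisson-commute on `P'`
    (∀ m m' : ℕ+, ∀ L ∈ PDO.PPrime k, PDO.poissonR (PDO.H m) (PDO.H m') L = 0) := by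
  refine ⟨fun F hF L => PDO.existsUnique_isGradient hF L, fun m => PDO.H_mem_functionals m,
    fun m L hL => ⟨PDO.forall_hasDirDeriv_iff m.ne_zero hL, PDO.isTangent_lax m hL⟩,
    fun T L h h0 => PDO.inPPrimeT_of_isHamiltonSolution (fun s : T => (s : ℕ+).ne_zero) h h0,
    fun T L hL s => PDO.isHamiltonSolution_iff_isLaxSolution (s : ℕ+).ne_zero s hL,
    fun T L h h0 m => ⟨_, PDO.isValue_H m L, fun s => ?_⟩,
    fun m m' L hL => PDO.poissonR_H_H m.ne_zero m'.ne_zero hL⟩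
  have hL := PDO.inPPrimeT_of_isHamiltonSolution (fun s : T => (s : ℕ+).ne_zero) h h0
  exact PDO.timeDeriv_hamiltonianT_eq_zero
    ((PDO.isHamiltonSolution_iff_isLaxSolution (s : ℕ+).ne_zero s hL).1 (h s)) m
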